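/- Let $n\in\mathbb{N}$, $h>0$, let $X=C([-h,0];\mathbb{R}^n)$ carry the supremum norm, let $O\subset X$ be open, and let $f:O\to\mathbb{R}^n$ be of class $C^k$, where $k\ge 1$ is an integer. Let $T_0$ be the shift semigroup on $X$, $(T_0(t)u)(\theta)=u(\min\{t+\theta,0\})$; let $X^{\odot}\subset X^*$ be the subspace on which the adjoint semigroup $T_0^*$ is strongly continuous, $T_0^\odot(t)=T_0^*(t)|_{X^\odot}$, and let $T_0^{\odot *}(t)=T_0^{\odot}(t)^*$ be its adjoint on $X^{\odot *}=(X^\odot)^*$. Let $\imath:X\to X^{\odot *}$, $\langle \imath u,x^\odot\rangle=\langle x^\odot,u\rangle$, be the canonical embedding. Under $X^\odot\cong\mathbb{R}^n\times L^1([0,h];\mathbb{R}^n)$, where $(c,v)$ acts by $u\mapsto \langle c,u(0)\rangle+\int_0^h\langle v(s),u(-s)\rangle\,ds$, let $r_i^{\odot *}\in X^{\odot *}$ be the functional $(c,v)\mapsto c_i$, and put $F(u)=\sum_{i=1}^n f_i(u)\,r_i^{\odot *}$. Let $\varphi$ be the semiflow of the delay equation $\dot x(t)=f(x_t)$, $x_0=u$,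 in the sun-star setting: for $t\ge 0$, $\mathcal{D}_t^\varphi$ is the set of $u\in O$ for which there is a continuous map $[0,t]\to O$, $s\mapsto x_s$, with $$x_s=T_0(s)u+\imath^{-1}\int_0^s T_0^{\odot *}(s-\tau)F(x_\tau)\,d\tau\qquad(0\le s\le t),$$ the integral being a weak* integral, and $\varphi_t(u)=x_t$ for $u\in\mathcal{D}_t^\varphi$. 1. For every $u\in O$ there exist $t>0$ and an open neighbourhood $U\subset\mathcal{D}_t^\varphi$ of $u$ such that $\varphi_t|_U$, and indeed $\varphi_s|_U$ for every $s\in[0,t]$, is of class $C^k$. Moreover, for each integer $0\le j\le k$ and all fixed $v_1,\dots,v_j\in X$, the map $(s,w)\mapsto D^j\varphi_s(w)[v_1,\dots,v_j]$ is jointly continuous on $[0,t]\times U$. 2. For every fixed $t\ge 0$, the set $\mathcal{D}_t^\varphi$ is open in $X$ and $\varphi_t$ is of class $C^k$ on $\mathcal{D}_t^\varphi$. -/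

import Mathlib

open Set Filter Topology MeasureTheory

namespace DelayEq

noncomputable section

/-- The phase space `X = C([-h, 0]; ℝⁿ)` with the supremum norm. -/
def PhaseSpace (n : ℕ) (h : ℝ) : Type :=
  C(Icc (-h) (0 : ℝ), EuclideanSpace ℝ (Fin n))

variable {n : ℕ} {h : ℝ}

instance : NormedAddCommGroup (PhaseSpace n h) :=
  inferInstanceAs (NormedAddCommGroup C(Icc (-h) (0 : ℝ), EuclideanSpace ℝ (Fin n)))

instance : NormedSpace ℝ (PhaseSpace n h) :=
  inferInstanceAs (NormedSpace ℝ C(Icc (-h) (0 : ℝ), EuclideanSpace ℝ (Fin n)))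

instance : CompleteSpace (PhaseSpace n h) :=
  inferInstanceAs (CompleteSpace C(Icc (-h) (0 : ℝ), EuclideanSpace ℝ (Fin n)))

instance : FunLike (PhaseSpace n h) (Icc (-h) (0 : ℝ)) (EuclideanSpace ℝ (Fin n)) :=
  inferInstanceAs (FunLike C(Icc (-h) (0 : ℝ), EuclideanSpace ℝ (Fin n)) _ _)

instance : ContinuousMapClass (PhaseSpace n h) (Icc (-h) (0 : ℝ)) (EuclideanSpace ℝ (Fin n)) :=
  inferInstanceAs (ContinuousMapClass C(Icc (-h) (0 : ℝ), EuclideanSpace ℝ (Fin n)) _ _)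

theorem PhaseSpace.ext {u v : PhaseSpace n h} (huv : ∀ θ, u θ = v θ) : u = v :=
  ContinuousMap.ext huv

theorem PhaseSpace.add_apply (u v : PhaseSpace n h) (θ : Icc (-h) (0 : ℝ)) :
    (u + v) θ = u θ + v θ := rfl

theorem PhaseSpace.sub_apply (u v : PhaseSpace n h) (θ : Icc (-h) (0 : ℝ)) :
    (u - v) θ = u θ - v θ := rfl

theorem PhaseSpace.smul_apply (c : ℝ) (u : PhaseSpace n h) (θ : Icc (-h) (0 : ℝ)) :
    (c • u) θ = c • u θ := rfl

theorem PhaseSpace.sum_apply {ι : Type*} (s : Finset ι) (u : ι → PhaseSpace n h)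
    (θ : Icc (-h) (0 : ℝ)) : (∑ i ∈ s, u i) θ = ∑ i ∈ s, u i θ :=
  map_sum ({ toFun := fun w => w θ, map_zero' := rfl, map_add' := fun _ _ => rfl } :
    PhaseSpace n h →+ EuclideanSpace ℝ (Fin n)) u s

theorem PhaseSpace.norm_le {u : PhaseSpace n h} {C : ℝ} (hC : 0 ≤ C) :
    ‖u‖ ≤ C ↔ ∀ θ, ‖u θ‖ ≤ C :=
  ContinuousMap.norm_le (α := Icc (-h) (0 : ℝ)) (E := EuclideanSpace ℝ (Fin n)) u hC

/-! ### The shift semigroup -/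

/-- The map `θ ↦ min (t + θ) 0` of `[-h, 0]` into itself, for `t ≥ 0`. -/
def shiftMap (h : ℝ) (t : NNReal) : C(Icc (-h) (0 : ℝ), Icc (-h) (0 : ℝ)) where
  toFun θ := ⟨min (t + θ) 0,
    le_min (θ.2.1.trans (le_add_of_nonneg_left t.2)) (θ.2.1.trans θ.2.2), min_le_right _ _⟩
  continuous_toFun := by fun_prop

/-- The shift semigroup `T₀` on `X`: `(T₀(t) u)(θ) = u(t + θ)` if `t + θ ≤ 0`, and `u(0)` if
`t + θ ≥ 0`. -/
def shiftSemigroup (t : NNReal) : PhaseSpace n h →L[ℝ] PhaseSpace n h where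
  toFun u := ContinuousMap.comp (α := Icc (-h) (0 : ℝ)) (β := Icc (-h) (0 : ℝ)) u (shiftMap h t)
  map_add' _ _ := rfl
  map_smul' _ _ := rfl
  cont := ContinuousMap.continuous_precomp _

theorem shiftSemigroup_apply (t : NNReal) (u : PhaseSpace n h) (θ : Icc (-h) (0 : ℝ)) :
    shiftSemigroup t u θ = u (shiftMap h t θ) := rfl

theorem shiftSemigroup_comm (s t : NNReal) (u : PhaseSpace n h) :
    shiftSemigroup s (shiftSemigroup t u) = shiftSemigroup t (shiftSemigroup s u) := by
  refine PhaseSpace.ext fun θ => ?_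
  simp only [shiftSemigroup_apply]
  congr 1
  ext1
  have hs : (0 : ℝ) ≤ s := s.2
  have ht : (0 : ℝ) ≤ t := t.2
  simp only [shiftMap, ContinuousMap.coe_mk]
  grind

/-! ### The sun dual `X^⊙` and the sun-star dual `X^{⊙*}` -/

/-- The adjoint semigroup `T₀^*(t)` on the dual space `X^*`. -/
def adjointSemigroup (t : NNReal) :
    StrongDual ℝ (PhaseSpace n h) →L[ℝ] StrongDual ℝ (PhaseSpace n h) :=
  (shiftSemigroup t).precomp ℝ

theorem adjointSemigroup_apply (t : NNReal) (x : StrongDual ℝ (PhaseSpace n h))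
    (u : PhaseSpace n h) : adjointSemigroup t x u = x (shiftSemigroup t u) := rfl

/-- The sun subspace `X^⊙` of `X^*`: the functionals on which the adjoint semigroup is strongly
continuous. -/
def sunSubspace (n : ℕ) (h : ℝ) : Submodule ℝ (StrongDual ℝ (PhaseSpace n h)) where
  carrier := {x | Tendsto (fun t : NNReal => adjointSemigroup t x) (𝓝[>] 0) (𝓝 x)}
  add_mem' {x y} hx hy := by
    simp only [mem_ofPred_eq, map_add] at *
    exact hx.add hy
  zero_mem' := by simp
  smul_mem' c x hx := by
    simp only [mem_ofPred_eq, map_smul] at *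
    exact hx.const_smul c

theorem adjointSemigroup_mem_sunSubspace (t : NNReal) {x : StrongDual ℝ (PhaseSpace n h)}
    (hx : x ∈ sunSubspace n h) : adjointSemigroup t x ∈ sunSubspace n h := by
  have hx' : Tendsto (fun s : NNReal => adjointSemigroup s x) (𝓝[>] 0) (𝓝 x) := hx
  have h1 := ((adjointSemigroup (n := n) (h := h) t).continuous.tendsto x).comp hx'
  refine h1.congr fun s => ?_
  ext u
  simp only [Function.comp_apply, adjointSemigroup_apply, shiftSemigroup_comm]

/-- The sun subspace as a normed space (with the norm of `X^*`). -/
def SunDual (n : ℕ) (h : ℝ) : Type := sunSubspace n h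

instance : NormedAddCommGroup (SunDual n h) :=
  inferInstanceAs (NormedAddCommGroup (sunSubspace n h))

instance : NormedSpace ℝ (SunDual n h) :=
  inferInstanceAs (NormedSpace ℝ (sunSubspace n h))

/-- The inclusion `X^⊙ → X^*`. -/
def sunInclusion : SunDual n h →L[ℝ] StrongDual ℝ (PhaseSpace n h) :=
  LinearMap.mkContinuous (E := SunDual n h) (sunSubspace n h).subtype 1
    fun x => (one_mul ‖x‖).symm ▸ le_refl ‖x‖

/-- The restriction `T₀^⊙(t)` of `T₀^*(t)` to `X^⊙`. -/
def sunSemigroup (t : NNReal) : SunDual n h →L[ℝ] SunDual n h :=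
  LinearMap.mkContinuous (E := SunDual n h) (F := SunDual n h)
    ((adjointSemigroup t).toLinearMap.restrict fun _ hx => adjointSemigroup_mem_sunSubspace t hx)
    ‖adjointSemigroup (n := n) (h := h) t‖ fun x => (adjointSemigroup t).le_opNorm (sunInclusion x)

theorem sunInclusion_sunSemigroup (t : NNReal) (x : SunDual n h) :
    sunInclusion (sunSemigroup t x) = adjointSemigroup t (sunInclusion x) := rfl

/-- The dual space `X^{⊙*}` of `X^⊙`. -/
abbrev SunStarDual (n : ℕ) (h : ℝ) : Type := StrongDual ℝ (SunDual n h)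

/-- The adjoint `T₀^{⊙*}(t)` of `T₀^⊙(t)` on `X^{⊙*}`. -/
def sunStarSemigroup (t : NNReal) : SunStarDual n h →L[ℝ] SunStarDual n h :=
  (sunSemigroup t).precomp ℝ

theorem sunStarSemigroup_apply (t : NNReal) (ξ : SunStarDual n h) (x : SunDual n h) :
    sunStarSemigroup t ξ x = ξ (sunSemigroup t x) := rfl

/-- The embedding `ι : X → X^{⊙*}`, `⟨ι u, x⟩ = ⟨x, u⟩`. -/
def sunEmbedding : PhaseSpace n h →L[ℝ] SunStarDual n h :=
  (sunInclusion.precomp ℝ).comp (NormedSpace.inclusionInDoubleDual ℝ (PhaseSpace n h))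

theorem sunEmbedding_apply (u : PhaseSpace n h) (x : SunDual n h) :
    sunEmbedding u x = sunInclusion x u := rfl

/-! ### The elements `r_i^{⊙*} = (e_i, 0)` of `X^{⊙*}`

Under the identification `X^⊙ ≅ ℝⁿ × L¹([0, h]; ℝⁿ)`, in which `(c, v)` acts on `u ∈ X` as
`⟨c, u(0)⟩ + ∫₀^h ⟨v(s), u(-s)⟩ ds`, the element `(e_i, 0)` is the functional `(c, v) ↦ c_i`. It reads
off the mass at `0` of the `i`-th component of the measure which represents an element of `X^⊙`,
so it is the weak* limit of `ι (ψ_m e_i)` as `m → ∞`, where `ψ_m(θ) = max (1 + m θ) 0`.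
The theorem `sunStarUnit_apply_of_forall` below confirms the formula `(c, v) ↦ c_i`. -/

/-- The function `θ ↦ max (1 + m θ) 0 • e_i` on `[-h, 0]`. -/
def spike (n : ℕ) (h : ℝ) (i : Fin n) (m : ℕ) : PhaseSpace n h :=
  ContinuousMap.mk (fun θ : Icc (-h) (0 : ℝ) =>
    max (1 + m * (θ : ℝ)) 0 • (EuclideanSpace.single i (1 : ℝ) : EuclideanSpace ℝ (Fin n)))
    (by fun_prop)

theorem spike_apply (i : Fin n) (m : ℕ) (θ : Icc (-h) (0 : ℝ)) :
    spike n h i m θ = max (1 + m * (θ : ℝ)) 0 • EuclideanSpace.single i (1 : ℝ) := rfl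

theorem norm_spike_le (i : Fin n) (m : ℕ) : ‖spike n h i m‖ ≤ 1 := by
  refine (PhaseSpace.norm_le zero_le_one).2 fun θ => ?_
  have h1 : (m : ℝ) * (θ : ℝ) ≤ 0 := mul_nonpos_of_nonneg_of_nonpos (by positivity) θ.2.2
  simp only [spike_apply, norm_smul, PiLp.norm_single, norm_one, mul_one,
    Real.norm_eq_abs]
  rw [abs_of_nonneg (le_max_right _ _)]
  exact max_le (by linarith) zero_le_one

theorem sum_abs_spike_le (i : Fin n) (x : StrongDual ℝ (PhaseSpace n h)) (N : ℕ) :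
    ∑ m ∈ Finset.range N, |x (spike n h i m) - x (spike n h i (m + 1))| ≤ ‖x‖ := by
  set ε : ℕ → ℝ := fun m => SignType.sign (x (spike n h i m) - x (spike n h i (m + 1))) with hε
  set w : PhaseSpace n h :=
    ∑ m ∈ Finset.range N, ε m • (spike n h i m - spike n h i (m + 1)) with hw
  have h1 : ∑ m ∈ Finset.range N, |x (spike n h i m) - x (spike n h i (m + 1))| = x w := by
    simp only [hw, map_sum, map_smul, map_sub, hε, smul_eq_mul]
    exact Finset.sum_congr rfl fun m _ => (sign_mul_self _).symm
  have h2 : ‖w‖ ≤ 1 := by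
    refine (PhaseSpace.norm_le zero_le_one).2 fun θ => ?_
    set a : ℕ → ℝ := fun m => max (1 + m * (θ : ℝ)) 0 with ha
    have hθ : (θ : ℝ) ≤ 0 := θ.2.2
    have hmono : ∀ m, 0 ≤ a m - a (m + 1) := fun m => by
      have : 1 + ((m + 1 : ℕ) : ℝ) * (θ : ℝ) ≤ 1 + m * (θ : ℝ) := by push_cast; linarith
      exact sub_nonneg.2 (max_le_max this le_rfl)
    have h3 : w θ = ∑ m ∈ Finset.range N,
        (ε m * (a m - a (m + 1))) • EuclideanSpace.single i (1 : ℝ) := by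
      simp only [hw, PhaseSpace.sum_apply, PhaseSpace.smul_apply, PhaseSpace.sub_apply]
      refine Finset.sum_congr rfl fun m _ => ?_
      simp only [spike_apply, ha, ← sub_smul, smul_smul]
    have h4 : ∀ m, |ε m| ≤ 1 := fun m => by
      simp only [hε]
      rcases SignType.sign (x (spike n h i m) - x (spike n h i (m + 1))) with _ | _ | _ <;> simp
    calc ‖w θ‖ ≤ ∑ m ∈ Finset.range N, (a m - a (m + 1)) := by
          rw [h3]
          refine (norm_sum_le _ _).trans (Finset.sum_le_sum fun m _ => ?_)
          rw [norm_smul, PiLp.norm_single, norm_one, mul_one, Real.norm_eq_abs, abs_mul,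
            abs_of_nonneg (hmono m)]
          exact mul_le_of_le_one_left (hmono m) (h4 m)
      _ = a 0 - a N := Finset.sum_range_sub' a N
      _ ≤ 1 := by
          have h5 : a 0 = 1 := by simp [ha]
          have h6 : 0 ≤ a N := le_max_right _ _
          linarith
  rw [h1]
  calc x w ≤ ‖x w‖ := Real.le_norm_self _
    _ ≤ ‖x‖ * ‖w‖ := x.le_opNorm w
    _ ≤ ‖x‖ := mul_le_of_le_one_right (norm_nonneg _) h2

theorem exists_tendsto_spike (i : Fin n) (x : StrongDual ℝ (PhaseSpace n h)) :
    ∃ c : ℝ, Tendsto (fun m => x (spike n h i m)) atTop (𝓝 c) := by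
  refine cauchySeq_tendsto_of_complete (cauchySeq_of_summable_dist ?_)
  exact summable_of_sum_range_le (fun _ => dist_nonneg)
    fun N => by simpa only [Real.dist_eq] using sum_abs_spike_le i x N

/-- The mass at `0` of the `i`-th component of (the measure representing) `x ∈ X^*`. -/
def massAtZero (i : Fin n) (x : StrongDual ℝ (PhaseSpace n h)) : ℝ :=
  (exists_tendsto_spike i x).choose

theorem tendsto_massAtZero (i : Fin n) (x : StrongDual ℝ (PhaseSpace n h)) :
    Tendsto (fun m => x (spike n h i m)) atTop (𝓝 (massAtZero i x)) :=
  (exists_tendsto_spike i x).choose_spec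

/-- The element `r_i^{⊙*} = (e_i, 0)` of `X^{⊙*}`. -/
def sunStarUnit (i : Fin n) : SunStarDual n h :=
  LinearMap.mkContinuous
    { toFun := fun x => massAtZero i (sunInclusion x)
      map_add' := fun x y => tendsto_nhds_unique (tendsto_massAtZero i _)
        ((tendsto_massAtZero i (sunInclusion x)).add
          (tendsto_massAtZero i (sunInclusion y)))
      map_smul' := fun c x => tendsto_nhds_unique (tendsto_massAtZero i _)
        ((tendsto_massAtZero i (sunInclusion x)).const_mul c) }
    1 fun x => by
      rw [one_mul]
      refine le_of_tendsto (tendsto_massAtZero i (sunInclusion x)).norm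
        (Eventually.of_forall fun m => ?_)
      exact ((sunInclusion x).le_opNorm _).trans
        (mul_le_of_le_one_right (norm_nonneg _) (norm_spike_le i m))

/-- If `x ∈ X^⊙` corresponds to the pair `(c, v)`, then `⟨r_i^{⊙*}, x⟩ = c_i`. -/
theorem sunStarUnit_apply_of_forall (hh : 0 ≤ h) (i : Fin n) (x : SunDual n h)
    (c : EuclideanSpace ℝ (Fin n)) (v : ℝ → EuclideanSpace ℝ (Fin n))
    (hv : IntegrableOn v (Icc 0 h))
    (hx : ∀ u : PhaseSpace n h, (sunInclusion x) u =
      inner ℝ c (u ⟨0, neg_nonpos.2 hh, le_rfl⟩) +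
        ∫ s in Icc 0 h, inner ℝ (v s) (IccExtend (neg_nonpos.2 hh) u (-s))) :
    sunStarUnit i x = c i := by
  refine tendsto_nhds_unique (tendsto_massAtZero i (sunInclusion x)) ?_
  have h0 : ∀ m, inner ℝ c (spike n h i m ⟨0, neg_nonpos.2 hh, le_rfl⟩) = c i := fun m => by
    simp [spike_apply, EuclideanSpace.inner_single_right]
  have key : Tendsto (fun m => ∫ s in Icc 0 h,
      inner ℝ (v s) (IccExtend (neg_nonpos.2 hh) (spike n h i m) (-s))) atTop
      (𝓝 (∫ s in Icc 0 h, (0 : ℝ))) := by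
    refine tendsto_integral_of_dominated_convergence (fun s => ‖v s‖) (fun m => ?_) hv.norm
      (fun m => ?_) ?_
    · exact hv.aestronglyMeasurable.inner
        ((map_continuous (spike n h i m)).Icc_extend'.comp continuous_neg).aestronglyMeasurable
    · refine Eventually.of_forall fun s => (norm_inner_le_norm _ _).trans ?_
      exact mul_le_of_le_one_right (norm_nonneg _)
        ((PhaseSpace.norm_le zero_le_one).1 (norm_spike_le i m) _)
    · have hne : ∀ᵐ s ∂(volume.restrict (Icc 0 h)), s ≠ 0 :=
        ae_restrict_of_ae (Measure.ae_ne volume 0)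
      filter_upwards [hne, ae_restrict_mem measurableSet_Icc] with s hs hmem
      have hpos : 0 < s := lt_of_le_of_ne hmem.1 (Ne.symm hs)
      refine tendsto_const_nhds.congr' ?_
      obtain ⟨M, hM⟩ := exists_nat_gt (1 / s)
      filter_upwards [eventually_ge_atTop M] with m hm
      have h1 : 1 < m * s := by
        have : (M : ℝ) ≤ m := by exact_mod_cast hm
        exact (div_lt_iff₀ hpos).1 (hM.trans_le this)
      have hmem' : -s ∈ Icc (-h) (0 : ℝ) := ⟨neg_le_neg hmem.2, neg_nonpos.2 hmem.1⟩
      rw [IccExtend_of_mem _ _ hmem']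
      have h2 : max (1 + (m : ℝ) * -s) 0 = 0 := max_eq_right (by linarith)
      simp only [spike_apply, h2, zero_smul, inner_zero_right]
  have := key.const_add (c i)
  simp only [integral_zero, add_zero] at this
  refine this.congr fun m => ?_
  rw [hx, h0]

/-! ### The equation and its semiflow -/

/-- The nonlinearity `F(u) = ∑ i, ⟨f(u), e_i⟩ r_i^{⊙*}` with values in `X^{⊙*}`. -/
def sunStarRhs (f : PhaseSpace n h → EuclideanSpace ℝ (Fin n)) (u : PhaseSpace n h) :
    SunStarDual n h :=
  ∑ i, f u i • sunStarUnit i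

/-- `g : ℝ → E^*` is weak* integrable on `s` and `I ∈ E^*` is its weak* integral. -/
def HasWeakStarIntegral {E : Type*} [NormedAddCommGroup E] [NormedSpace ℝ E]
    (g : ℝ → StrongDual ℝ E) (s : Set ℝ) (I : StrongDual ℝ E) : Prop :=
  ∀ x : E, IntegrableOn (fun τ => g τ x) s ∧ I x = ∫ τ in s, g τ x

/-- `x : [0, t] → O` is a continuous solution of the variation-of-constants equation
`x(s) = T₀(s) u + ι⁻¹ ∫₀ˢ T₀^{⊙*}(s - τ) F(x(τ)) dτ` (weak* integral) for `0 ≤ s ≤ t`. -/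
structure IsSolution (O : Set (PhaseSpace n h)) (f : PhaseSpace n h → EuclideanSpace ℝ (Fin n))
    (u : PhaseSpace n h) (t : ℝ) (x : ℝ → PhaseSpace n h) : Prop where
  continuousOn : ContinuousOn x (Icc 0 t)
  mem : ∀ s ∈ Icc 0 t, x s ∈ O
  eq : ∀ s ∈ Icc 0 t, HasWeakStarIntegral
    (fun τ => sunStarSemigroup (s - τ).toNNReal (sunStarRhs f (x τ))) (Icc 0 s)
    (sunEmbedding (x s - shiftSemigroup s.toNNReal u))

/-- The set `D_t` of initial states in `O` whose solution exists on `[0, t]` (within `O`): the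
time-`t` slice of the domain of the maximal semiflow. -/
def semiflowDomain (O : Set (PhaseSpace n h)) (f : PhaseSpace n h → EuclideanSpace ℝ (Fin n))
    (t : ℝ) : Set (PhaseSpace n h) :=
  {u | u ∈ O ∧ ∃ x, IsSolution O f u t x}

open Classical in
/-- The time-`t` map `φ_t : D_t → O` of the semiflow, which sends `u ∈ D_t` to the value at time
`t` of the solution that starts at `u`. (Solutions are unique for locally Lipschitz `f`; outside
`D_t` the value is irrelevant.) -/
def semiflow (O : Set (PhaseSpace n h)) (f : PhaseSpace n h → EuclideanSpace ℝ (Fin n))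
    (t : ℝ) (u : PhaseSpace n h) : PhaseSpace n h :=
  if hu : ∃ x, IsSolution O f u t x then hu.choose t else u

end

end DelayEq

/-! The equation on `[0, t]` becomes one equation in the Banach space `C([0, t]; X)`: `z = S u + P
(f ∘ z)`, where `S` (`shiftCurve`) and `P` (`primitiveCurve`) are bounded linear and `P g` has the
state `θ ↦ ∫₀^{max (s + θ) 0} g` at time `s`. This rests on `hasWeakStarIntegral_primitiveState`,
which computes the weak* integral, and on the injectivity of `ι` (`sunEmbedding_injective`).

Curves have compact range, so `z ↦ f ∘ z` is of class `C^k` (`contDiffOn_superposition`), and hence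
so is `Φ z = z - P (f ∘ z)`. Its derivative is the identity minus a Volterra operator. The powers of
the latter decay factorially, so the derivative is invertible for every `t`, not only for small `t`
(`isUnit_one_sub_of_volterra`). By the inverse function theorem at a given solution, all nearby
initial states have solutions on the same `[0, t]`, and the whole solution curve is a `C^k` function
of the initial state.

Uniqueness identifies these curves with the semiflow. Evaluation at a time is linear and continuous,
which gives the smoothness of `φ_s` and the joint continuity of its derivatives. Openness of the
domain at an arbitrary `t` follows at once, without continuation along the orbit; a contraction
argument supplies short-time existence. -/

namespace DelayEq

noncomputable section

universe u

/-! ### Superposition operators on spaces of continuous functions -/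

section Superposition

variable {K E F : Type*} [TopologicalSpace K] [NormedAddCommGroup E] [NormedAddCommGroup F]

open Classical in
/-- The superposition operator `z ↦ f ∘ z`, with value `0` where `f ∘ z` is not continuous. -/
def superposition (f : E → F) (z : C(K, E)) : C(K, F) :=
  if hc : Continuous (f ∘ z) then ⟨f ∘ z, hc⟩ else 0

theorem superposition_apply {f : E → F} {O : Set E} (hf : ContinuousOn f O) {z : C(K, E)}
    (hz : ∀ s, z s ∈ O) (s : K) : superposition f z s = f (z s) := by
  have hc : Continuous (f ∘ z) := hf.comp_continuous z.continuous hz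
  simp only [superposition, dif_pos hc, ContinuousMap.coe_mk, Function.comp_apply]

variable [CompactSpace K]

theorem isOpen_setOf_forall_mem {O : Set E} (hO : IsOpen O) :
    IsOpen {z : C(K, E) | ∀ s, z s ∈ O} := by
  simpa only [MapsTo, mem_univ, forall_true_left] using
    ContinuousMap.isOpen_setOfPred_mapsTo (X := K) isCompact_univ hO

/-- The range of `z` is compact, so one `δ` serves at every `z s`. The point `p` need not lie in the
range, only near it. -/
theorem exists_forall_dist_lt_of_continuousOn {f : E → F} {O : Set E} (hO : IsOpen O)
    (hf : ContinuousOn f O) {z : C(K, E)} (hz : ∀ s, z s ∈ O) {ε : ℝ} (hε : 0 < ε) :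
    ∃ δ > 0, ∀ s p, dist p (z s) < δ → p ∈ O ∧ dist (f p) (f (z s)) < ε := by
  have hc : IsCompact (range z) := isCompact_range z.continuous
  have h1 := hc.uniformContinuousAt_of_continuousAt f
    (by rintro _ ⟨s, rfl⟩; exact hf.continuousAt (hO.mem_nhds (hz s))) (Metric.dist_mem_uniformity hε)
  obtain ⟨δ₁, hδ₁, h1⟩ := Metric.mem_uniformity_dist.1 h1
  obtain ⟨δ₂, hδ₂, h2⟩ := hc.exists_thickening_subset_open hO (by rintro _ ⟨s, rfl⟩; exact hz s)
  refine ⟨min δ₁ δ₂, lt_min hδ₁ hδ₂, fun s p hp => ⟨h2 ?_, ?_⟩⟩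
  · exact Metric.mem_thickening_iff.2 ⟨z s, ⟨s, rfl⟩, hp.trans_le (min_le_right _ _)⟩
  · rw [dist_comm]
    exact h1 (by rw [dist_comm]; exact hp.trans_le (min_le_left _ _)) ⟨s, rfl⟩

theorem continuousOn_superposition {f : E → F} {O : Set E} (hO : IsOpen O)
    (hf : ContinuousOn f O) :
    ContinuousOn (superposition (K := K) f) {z | ∀ s, z s ∈ O} := by
  intro z hz
  refine ContinuousAt.continuousWithinAt (Metric.continuousAt_iff.2 fun ε hε => ?_)
  obtain ⟨δ, hδ, H⟩ := exists_forall_dist_lt_of_continuousOn hO hf hz (half_pos hε)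
  refine ⟨δ, hδ, fun {y} hy => ?_⟩
  have hys : ∀ s, dist (y s) (z s) < δ := fun s => (ContinuousMap.dist_apply_le_dist s).trans_lt hy
  refine lt_of_le_of_lt ((ContinuousMap.dist_le (half_pos hε).le).2 fun s => ?_) (half_lt_self hε)
  rw [superposition_apply hf (fun s => (H s _ (hys s)).1), superposition_apply hf hz]
  exact (H s _ (hys s)).2.le

variable [NormedSpace ℝ E] [NormedSpace ℝ F]

/-- The operator which sends a continuous family `A` of linear maps to the multiplication operator
`y ↦ (s ↦ A s (y s))`. -/
def pointwiseApply : C(K, E →L[ℝ] F) →L[ℝ] C(K, E) →L[ℝ] C(K, F) :=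
  LinearMap.mkContinuous₂
    (LinearMap.mk₂ ℝ (fun (A : C(K, E →L[ℝ] F)) (y : C(K, E)) =>
        (⟨fun s => A s (y s), A.continuous.clm_apply y.continuous⟩ : C(K, F)))
      (fun _ _ _ => rfl) (fun _ _ _ => rfl)
      (fun A y y' => ContinuousMap.ext fun s => map_add (A s) (y s) (y' s))
      (fun c A y => ContinuousMap.ext fun s => map_smul (A s) c (y s))) 1
    fun A y => by
      rw [one_mul]
      refine (ContinuousMap.norm_le _ (by positivity)).2 fun s => ?_
      exact ((A s).le_opNorm _).trans
        (mul_le_mul (A.norm_coe_le_norm s) (y.norm_coe_le_norm s) (norm_nonneg _) (norm_nonneg A))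

theorem pointwiseApply_apply (A : C(K, E →L[ℝ] F)) (y : C(K, E)) (s : K) :
    pointwiseApply A y s = A s (y s) := rfl

theorem hasFDerivAt_superposition {f : E → F} {O : Set E} (hO : IsOpen O)
    (hf : ContDiffOn ℝ 1 f O) {z : C(K, E)} (hz : ∀ s, z s ∈ O) :
    HasFDerivAt (superposition f) (pointwiseApply (superposition (fderiv ℝ f) z)) z := by
  have hf' : ContinuousOn (fderiv ℝ f) O := hf.continuousOn_fderiv_of_isOpen hO le_rfl
  rw [hasFDerivAt_iff_isLittleO_nhds_zero, Asymptotics.isLittleO_iff]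
  intro ε hε
  obtain ⟨δ, hδ, H⟩ := exists_forall_dist_lt_of_continuousOn hO hf' hz hε
  filter_upwards [Metric.ball_mem_nhds (0 : C(K, E)) hδ] with y hy
  have hyδ : ‖y‖ < δ := by simpa using hy
  have hys : ∀ s, dist ((z + y) s) (z s) < δ := fun s => by
    simpa [dist_eq_norm] using (y.norm_coe_le_norm s).trans_lt hyδ
  refine (ContinuousMap.norm_le _ (by positivity)).2 fun s => ?_
  simp only [ContinuousMap.sub_apply, pointwiseApply_apply]
  rw [superposition_apply hf.continuousOn (fun s => (H s _ (hys s)).1),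
    superposition_apply hf.continuousOn hz, superposition_apply hf' hz]
  -- Mean value inequality on a ball where `fderiv ℝ f` is within `ε` of its value at the centre;
  -- `δ` does not depend on `s`, so the estimate is uniform.
  have key := (convex_ball (z s) δ).norm_image_sub_le_of_norm_hasFDerivWithin_le' (f := f)
    (f' := fderiv ℝ f) (φ := fderiv ℝ f (z s)) (C := ε) (x := z s) (y := (z + y) s)
    (fun p hp => ((hf.differentiableOn one_ne_zero).differentiableAt
      (hO.mem_nhds (H s p hp).1)).hasFDerivAt.hasFDerivWithinAt)
    (fun p hp => by rw [← dist_eq_norm]; exact (H s p hp).2.le)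
    (Metric.mem_ball_self hδ) (hys s)
  simp only [ContinuousMap.add_apply, add_sub_cancel_left] at key ⊢
  exact key.trans (mul_le_mul_of_nonneg_left (y.norm_coe_le_norm s) hε.le)

/-- The derivative is again a superposition operator, that of `fderiv ℝ f`, followed by a bounded
linear map; hence the induction on `k` with `F` general. `E` and `F` share a universe so that `E
→L[ℝ] F` is an admissible target for the induction hypothesis. -/
theorem contDiffOn_superposition (k : ℕ) {E F : Type u} [NormedAddCommGroup E] [NormedSpace ℝ E]
    [NormedAddCommGroup F] [NormedSpace ℝ F] {f : E → F} {O : Set E} (hO : IsOpen O)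
    (hf : ContDiffOn ℝ k f O) :
    ContDiffOn ℝ k (superposition (K := K) f) {z | ∀ s, z s ∈ O} := by
  induction k generalizing F with
  | zero => exact contDiffOn_zero.2 (continuousOn_superposition hO hf.continuousOn)
  | succ k ih =>
    have hΩ : IsOpen {z : C(K, E) | ∀ s, z s ∈ O} := isOpen_setOf_forall_mem hO
    have hf1 : ContDiffOn ℝ 1 f O := hf.of_le (by norm_cast; omega)
    push_cast at hf ⊢
    rw [contDiffOn_succ_iff_fderiv_of_isOpen hO] at hf
    refine (contDiffOn_succ_iff_fderiv_of_isOpen hΩ).2 ⟨fun z hz =>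
      (hasFDerivAt_superposition hO hf1 hz).differentiableAt.differentiableWithinAt, by simp, ?_⟩
    have h1 := (pointwiseApply (K := K) (E := E) (F := F)).contDiff.comp_contDiffOn (ih hf.2.2)
    exact h1.congr fun z hz => (hasFDerivAt_superposition hO hf1 hz).fderiv

end Superposition

/-! ### Curves in the phase space -/

section Curves

variable {n : ℕ} {h : ℝ}

theorem PhaseSpace.continuous_of_uncurry {α : Type*} [TopologicalSpace α] {g : α → PhaseSpace n h}
    (hg : Continuous fun p : α × Icc (-h) (0 : ℝ) => g p.1 p.2) : Continuous g :=
  ContinuousMap.continuous_of_continuous_uncurry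
    (Y := Icc (-h) (0 : ℝ)) (Z := EuclideanSpace ℝ (Fin n)) g hg

theorem PhaseSpace.continuous_eval :
    Continuous fun p : PhaseSpace n h × Icc (-h) (0 : ℝ) => p.1 p.2 :=
  ContinuousEval.continuous_eval (F := C(Icc (-h) (0 : ℝ), EuclideanSpace ℝ (Fin n)))

theorem PhaseSpace.norm_apply_le (u : PhaseSpace n h) (θ : Icc (-h) (0 : ℝ)) : ‖u θ‖ ≤ ‖u‖ :=
  (PhaseSpace.norm_le (norm_nonneg u)).1 le_rfl θ

theorem continuous_shiftSemigroup :
    Continuous fun p : NNReal × PhaseSpace n h => shiftSemigroup p.1 p.2 := by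
  refine PhaseSpace.continuous_of_uncurry ?_
  refine PhaseSpace.continuous_eval.comp (f := fun p : (NNReal × PhaseSpace n h) × Icc (-h) (0 : ℝ) =>
    (p.1.2, shiftMap h p.1.1 p.2)) (continuous_fst.snd.prodMk (Continuous.subtype_mk ?_ _))
  exact ((NNReal.continuous_coe.comp continuous_fst.fst).add
    (continuous_subtype_val.comp continuous_snd)).min continuous_const

theorem norm_shiftSemigroup_apply_le (t : NNReal) (u : PhaseSpace n h) :
    ‖shiftSemigroup t u‖ ≤ ‖u‖ :=
  (PhaseSpace.norm_le (norm_nonneg u)).2 fun _ => u.norm_apply_le _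

theorem shiftSemigroup_zero (u : PhaseSpace n h) : shiftSemigroup 0 u = u := by
  refine PhaseSpace.ext fun θ => ?_
  rw [shiftSemigroup_apply]
  congr 1
  ext1
  simpa [shiftMap] using θ.2.2

/-- The curve `s ↦ T₀(s) u` on `[0, t]`, as a function of `u`. -/
def shiftCurve (t : ℝ) : PhaseSpace n h →L[ℝ] C(Icc 0 t, PhaseSpace n h) :=
  LinearMap.mkContinuous
    { toFun := fun u => ⟨fun s => shiftSemigroup (s : ℝ).toNNReal u,
        continuous_shiftSemigroup.comp (by fun_prop : Continuous fun s : Icc 0 t =>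
          ((s : ℝ).toNNReal, u))⟩
      map_add' := fun u v => ContinuousMap.ext fun s => map_add (shiftSemigroup _) u v
      map_smul' := fun c u => ContinuousMap.ext fun s => map_smul (shiftSemigroup _) c u }
    1 fun u => (ContinuousMap.norm_le _ (by positivity)).2 fun s => by
      rw [one_mul]; exact norm_shiftSemigroup_apply_le _ u

theorem shiftCurve_apply (t : ℝ) (u : PhaseSpace n h) (s : Icc 0 t) :
    shiftCurve t u s = shiftSemigroup (s : ℝ).toNNReal u := rfl

/-- The state `θ ↦ ∫₀^{max (s + θ) 0} g`. -/
def primitiveState (h : ℝ) (g : C(ℝ, EuclideanSpace ℝ (Fin n))) (s : ℝ) : PhaseSpace n h :=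
  ContinuousMap.mk (fun θ : Icc (-h) (0 : ℝ) => ∫ τ in (0 : ℝ)..max (s + θ) 0, g τ)
    ((intervalIntegral.continuous_primitive (fun _ _ => g.continuous.intervalIntegrable _ _) 0).comp
      (by fun_prop))

theorem primitiveState_apply (g : C(ℝ, EuclideanSpace ℝ (Fin n))) (s : ℝ)
    (θ : Icc (-h) (0 : ℝ)) : primitiveState h g s θ = ∫ τ in (0 : ℝ)..max (s + θ) 0, g τ := rfl

theorem continuous_primitiveState (g : C(ℝ, EuclideanSpace ℝ (Fin n))) :
    Continuous (primitiveState h g) :=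
  PhaseSpace.continuous_of_uncurry
    ((intervalIntegral.continuous_primitive (fun _ _ => g.continuous.intervalIntegrable _ _) 0).comp
      (by fun_prop : Continuous fun p : ℝ × Icc (-h) (0 : ℝ) => max (p.1 + (p.2 : ℝ)) 0))

theorem norm_primitiveState_le (g : C(ℝ, EuclideanSpace ℝ (Fin n))) {s : ℝ} (hs : 0 ≤ s) :
    ‖primitiveState h g s‖ ≤ ∫ τ in (0 : ℝ)..s, ‖g τ‖ := by
  refine (PhaseSpace.norm_le (intervalIntegral.integral_nonneg hs fun _ _ => norm_nonneg _)).2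
    fun θ => ?_
  have hm : max (s + (θ : ℝ)) 0 ≤ s := max_le (by linarith [θ.2.2]) hs
  rw [primitiveState_apply]
  refine (intervalIntegral.norm_integral_le_integral_norm (le_max_right _ _)).trans ?_
  exact intervalIntegral.integral_mono_interval le_rfl (le_max_right _ _) hm
    (Eventually.of_forall fun _ => norm_nonneg _) (g.continuous.norm.intervalIntegrable _ _)

/-- The continuous extension of a curve on `[0, t]` to the line, constant outside `[0, t]`. -/
def extendCurve {E : Type*} [TopologicalSpace E] {t : ℝ} (ht : 0 ≤ t) (z : C(Icc 0 t, E)) :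
    C(ℝ, E) :=
  ⟨IccExtend ht z, z.continuous.Icc_extend'⟩

theorem extendCurve_of_mem {E : Type*} [TopologicalSpace E] {t : ℝ} (ht : 0 ≤ t)
    (z : C(Icc 0 t, E)) {s : ℝ} (hs : s ∈ Icc 0 t) : extendCurve ht z s = z ⟨s, hs⟩ :=
  IccExtend_of_mem _ _ hs

/-- The operator `g ↦ (s ↦ (θ ↦ ∫₀^{max (s + θ) 0} g))`. -/
def primitiveCurve (h : ℝ) {t : ℝ} (ht : 0 ≤ t) :
    C(Icc 0 t, EuclideanSpace ℝ (Fin n)) →L[ℝ] C(Icc 0 t, PhaseSpace n h) :=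
  LinearMap.mkContinuous
    { toFun := fun g => ⟨fun s => primitiveState h (extendCurve ht g) s,
        (continuous_primitiveState _).comp continuous_subtype_val⟩
      map_add' := fun g g' => ContinuousMap.ext fun s => PhaseSpace.ext fun θ =>
        intervalIntegral.integral_add ((extendCurve ht g).continuous.intervalIntegrable _ _)
          ((extendCurve ht g').continuous.intervalIntegrable _ _)
      map_smul' := fun c g => ContinuousMap.ext fun s => PhaseSpace.ext fun θ =>
        intervalIntegral.integral_smul c _ }
    t fun g => (ContinuousMap.norm_le _ (by positivity)).2 fun s => by
      refine (norm_primitiveState_le _ s.2.1).trans ?_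
      have h1 := intervalIntegral.norm_integral_le_of_norm_le_const
        (a := 0) (b := (s : ℝ)) (f := fun τ => ‖extendCurve ht g τ‖) (C := ‖g‖)
        fun τ _ => by rw [norm_norm]; exact g.norm_coe_le_norm _
      refine (Real.le_norm_self _).trans (h1.trans ?_)
      rw [sub_zero, abs_of_nonneg s.2.1, mul_comm]
      exact mul_le_mul_of_nonneg_right s.2.2 (norm_nonneg g)

theorem norm_primitiveCurve_le {t : ℝ} (ht : 0 ≤ t) :
    ‖(primitiveCurve h ht : C(Icc 0 t, EuclideanSpace ℝ (Fin n)) →L[ℝ] _)‖ ≤ t :=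
  LinearMap.mkContinuous_norm_le _ ht _

/-- Keeping the integral up to `s`, instead of `t` times a supremum, is what allows iteration to
gain factorials. -/
theorem norm_primitiveCurve_apply_le {t : ℝ} (ht : 0 ≤ t)
    (g : C(Icc 0 t, EuclideanSpace ℝ (Fin n))) (s : Icc 0 t) :
    ‖primitiveCurve h ht g s‖ ≤ ∫ τ in (0 : ℝ)..s, ‖extendCurve ht g τ‖ :=
  norm_primitiveState_le _ s.2.1

end Curves

/-! ### Volterra inequalities -/

section Volterra

/-- One step of the Volterra iteration, shared by the Gronwall argument and by the estimate for
powers of a Volterra operator. -/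
theorem mul_integral_le_pow_div_factorial {d : ℝ → ℝ} (hd : Continuous d) {a C s : ℝ}
    (ha : 0 ≤ a) (hs : 0 ≤ s) (j : ℕ)
    (hb : ∀ τ ∈ Icc 0 s, d τ ≤ (a * τ) ^ j / j.factorial * C) :
    a * ∫ τ in (0 : ℝ)..s, d τ ≤ (a * s) ^ (j + 1) / (j + 1).factorial * C := by
  have h1 : ∫ τ in (0 : ℝ)..s, d τ ≤ ∫ τ in (0 : ℝ)..s, (a ^ j / j.factorial * C) * τ ^ j :=
    intervalIntegral.integral_mono_on hs (hd.intervalIntegrable _ _)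
      ((by fun_prop : Continuous fun τ : ℝ => (a ^ j / j.factorial * C) * τ ^ j).intervalIntegrable
        _ _) fun τ hτ => (hb τ hτ).trans_eq (by ring)
  refine (mul_le_mul_of_nonneg_left h1 ha).trans_eq ?_
  rw [intervalIntegral.integral_const_mul, integral_pow, Nat.factorial_succ]
  have h2 : (j.factorial : ℝ) ≠ 0 := by positivity
  push_cast
  field_simp
  simp
  ring

theorem nonpos_of_le_mul_integral {d : ℝ → ℝ} (hd : Continuous d) {a t : ℝ} (ha : 0 ≤ a)
    (hb : ∀ s ∈ Icc 0 t, d s ≤ a * ∫ τ in (0 : ℝ)..s, d τ) : ∀ s ∈ Icc 0 t, d s ≤ 0 := by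
  obtain ⟨C, hC⟩ := (isCompact_Icc (a := (0 : ℝ)) (b := t)).bddAbove_image hd.continuousOn
  have h1 : ∀ j : ℕ, ∀ s ∈ Icc 0 t, d s ≤ (a * s) ^ j / j.factorial * C := fun j => by
    induction j with
    | zero => intro s hs; simpa using hC (mem_image_of_mem d hs)
    | succ j ih => exact fun s hs => (hb s hs).trans (mul_integral_le_pow_div_factorial hd ha hs.1 j
        fun τ hτ => ih τ ⟨hτ.1, hτ.2.trans hs.2⟩)
  intro s hs
  have h2 := (FloorSemiring.tendsto_pow_div_factorial_atTop (a * s)).mul_const C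
  rw [zero_mul] at h2
  exact ge_of_tendsto' h2 fun j => h1 j s hs

variable {E : Type*} [NormedAddCommGroup E] [NormedSpace ℝ E] [CompleteSpace E]

/-- Some power satisfies `‖V ^ j‖ < 1`, so `1 - V ^ j` is a unit by the Neumann series. It is the
product of `1 - V` and a geometric sum, which commute, so `1 - V` is a unit too. -/
theorem isUnit_one_sub_of_volterra {t : ℝ} (ht : 0 ≤ t)
    (V : C(Icc 0 t, E) →L[ℝ] C(Icc 0 t, E)) {a : ℝ} (ha : 0 ≤ a)
    (hV : ∀ y (s : Icc 0 t), ‖V y s‖ ≤ a * ∫ τ in (0 : ℝ)..s, ‖extendCurve ht y τ‖) :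
    IsUnit (1 - V) := by
  have h1 : ∀ (j : ℕ) y (s : Icc 0 t), ‖(V ^ j) y s‖ ≤ (a * s) ^ j / j.factorial * ‖y‖ :=
    fun j y => by
    induction j with
    | zero => intro s; simpa using y.norm_coe_le_norm s
    | succ j ih =>
      intro s
      rw [pow_succ', mul_apply_eq_comp]
      refine (hV _ s).trans (mul_integral_le_pow_div_factorial
        (extendCurve ht ((V ^ j) y)).continuous.norm ha s.2.1 j fun τ hτ => ?_)
      have hτ' : τ ∈ Icc 0 t := ⟨hτ.1, hτ.2.trans s.2.2⟩
      rw [extendCurve_of_mem ht _ hτ']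
      exact ih ⟨τ, hτ'⟩
  have h2 : ∀ j : ℕ, ‖V ^ j‖ ≤ (a * t) ^ j / j.factorial := fun j =>
    ContinuousLinearMap.opNorm_le_bound _ (by positivity) fun y =>
      (ContinuousMap.norm_le _ (by positivity)).2 fun s => (h1 j y s).trans
        (by have := s.2.1; have := s.2.2; gcongr)
  obtain ⟨j, hj⟩ := ((FloorSemiring.tendsto_pow_div_factorial_atTop (a * t)).eventually
    (gt_mem_nhds zero_lt_one)).exists
  have h3 : IsUnit (1 - V ^ j) := isUnit_one_sub_of_norm_lt_one
    (R := C(Icc 0 t, E) →L[ℝ] C(Icc 0 t, E)) ((h2 j).trans_lt hj)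
  rw [← mul_neg_geom_sum] at h3
  exact ((Commute.isUnit_mul_iff (by
    rw [Commute, SemiconjBy, mul_neg_geom_sum, geom_sum_mul_neg])).1 h3).1

end Volterra

/-! ### The weak* integral in the variation-of-constants equation -/

section WeakStar

variable {n : ℕ} {h : ℝ}

/-- Evaluation at a point of `[-h, 0]` as a continuous linear map. -/
def PhaseSpace.evalCLM (θ : Icc (-h) (0 : ℝ)) :
    PhaseSpace n h →L[ℝ] EuclideanSpace ℝ (Fin n) :=
  LinearMap.mkContinuous
    { toFun := fun u => u θ
      map_add' := fun u v => PhaseSpace.add_apply u v θ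
      map_smul' := fun c u => PhaseSpace.smul_apply c u θ }
    1 fun u => by rw [one_mul]; exact u.norm_apply_le θ

theorem sum_smul_spike_apply (c : EuclideanSpace ℝ (Fin n)) (m : ℕ) (θ : Icc (-h) (0 : ℝ)) :
    (∑ i, c i • spike n h i m) θ = max (1 + m * (θ : ℝ)) 0 • c := by
  rw [PhaseSpace.sum_apply]
  ext j
  simp [PhaseSpace.smul_apply, spike_apply, Finset.sum_apply, Pi.single_apply, mul_comm]

theorem max_one_add_mul_le_one (m : ℕ) {r : ℝ} (hr : r ≤ 0) : max (1 + m * r) 0 ≤ 1 :=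
  max_le (by linarith [mul_nonpos_of_nonneg_of_nonpos (Nat.cast_nonneg (α := ℝ) m) hr]) zero_le_one

theorem norm_sum_smul_spike_le (c : EuclideanSpace ℝ (Fin n)) (m : ℕ) :
    ‖∑ i, c i • spike n h i m‖ ≤ ‖c‖ := by
  refine (PhaseSpace.norm_le (norm_nonneg c)).2 fun θ => ?_
  rw [sum_smul_spike_apply, norm_smul, Real.norm_of_nonneg (le_max_right _ _)]
  exact mul_le_of_le_one_left (norm_nonneg c) (max_one_add_mul_le_one m θ.2.2)

/-- The shifted spikes `T₀(s - τ) (∑ i, gᵢ(τ) ψ_m e_i)`. -/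
def shiftedSpike (g : C(ℝ, EuclideanSpace ℝ (Fin n))) (h s : ℝ) (m : ℕ) (τ : ℝ) : PhaseSpace n h :=
  shiftSemigroup (s - τ).toNNReal (∑ i, g τ i • spike n h i m)

theorem continuous_shiftedSpike (g : C(ℝ, EuclideanSpace ℝ (Fin n))) (s : ℝ) (m : ℕ) :
    Continuous (shiftedSpike g h s m) :=
  continuous_shiftSemigroup.comp (f := fun τ => ((s - τ).toNNReal, ∑ i, g τ i • spike n h i m))
    (by fun_prop)

theorem norm_shiftedSpike_le (g : C(ℝ, EuclideanSpace ℝ (Fin n))) (s : ℝ) (m : ℕ) (τ : ℝ) :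
    ‖shiftedSpike g h s m τ‖ ≤ ‖g τ‖ :=
  (norm_shiftSemigroup_apply_le _ _).trans (norm_sum_smul_spike_le _ _)

theorem shiftedSpike_apply (g : C(ℝ, EuclideanSpace ℝ (Fin n))) {s τ : ℝ} (m : ℕ) (hτ : τ ≤ s)
    (θ : Icc (-h) (0 : ℝ)) :
    shiftedSpike g h s m τ θ = max (1 + m * min (s - τ + θ) 0) 0 • g τ := by
  simp only [shiftedSpike, shiftSemigroup_apply, sum_smul_spike_apply, shiftMap,
    ContinuousMap.coe_mk, Real.coe_toNNReal _ (sub_nonneg.2 hτ)]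

/-- At fixed `θ`, with `p = max (s + θ) 0`, the integrand equals `g` for `τ ≤ p`, vanishes for `τ >
p + 1 / m`, and is bounded by `C` in between. The error is therefore at most `C / m`, uniformly in
`θ`. -/
theorem norm_integral_shiftedSpike_sub_le (g : C(ℝ, EuclideanSpace ℝ (Fin n))) {s C : ℝ}
    (hs : 0 ≤ s) (hC : ∀ τ ∈ Icc 0 s, ‖g τ‖ ≤ C) {m : ℕ} (hm : 0 < m) :
    ‖(∫ τ in Icc 0 s, shiftedSpike g h s m τ) - primitiveState h g s‖ ≤ C * (1 / m) := by
  have hC0 : 0 ≤ C := (norm_nonneg _).trans (hC 0 ⟨le_rfl, hs⟩)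
  have hm' : (0 : ℝ) < m := by exact_mod_cast hm
  refine (PhaseSpace.norm_le (by positivity)).2 fun θ => ?_
  have hθ : (θ : ℝ) ≤ 0 := θ.2.2
  set p : ℝ := max (s + (θ : ℝ)) 0 with hp
  have hps : p ≤ s := max_le (by linarith) hs
  have hint : IntegrableOn (shiftedSpike g h s m) (Ioc 0 s) :=
    ((continuous_shiftedSpike g s m).integrableOn_Icc (a := 0) (b := s)).mono_set Ioc_subset_Icc_self
  have h1 : (∫ τ in Icc 0 s, shiftedSpike g h s m τ) θ =
      ∫ τ in Ioc 0 s, shiftedSpike g h s m τ θ := by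
    -- Without the null point `τ = 0`, the condition `τ ≤ p` forces `τ ≤ s + θ`.
    rw [integral_Icc_eq_integral_Ioc]
    exact ((PhaseSpace.evalCLM θ).integral_comp_comm hint).symm
  have h2 : primitiveState h g s θ = ∫ τ in Ioc 0 s, (Iic p).indicator g τ := by
    rw [setIntegral_indicator measurableSet_Iic, Ioc_inter_Iic, min_eq_right hps,
      primitiveState_apply, intervalIntegral.integral_of_le (le_max_right _ _)]
  have hint' : IntegrableOn (fun τ => shiftedSpike g h s m τ θ) (Ioc 0 s) :=
    (PhaseSpace.evalCLM θ).integrable_comp hint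
  rw [PhaseSpace.sub_apply, h1, h2, ← integral_sub hint'
    ((g.continuous.integrableOn_Icc.mono_set Ioc_subset_Icc_self).indicator measurableSet_Iic)]
  calc ‖∫ τ in Ioc 0 s, (shiftedSpike g h s m τ θ - (Iic p).indicator g τ)‖
      ≤ ∫ τ in Ioc 0 s, (Ioc p (p + 1 / m)).indicator (fun _ => C) τ := by
        refine norm_integral_le_of_norm_le ?_ ?_
        · exact (integrable_const C).indicator measurableSet_Ioc
        filter_upwards [ae_restrict_mem measurableSet_Ioc] with τ hτ
        rw [shiftedSpike_apply g m hτ.2]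
        have hg : ‖g τ‖ ≤ C := hC τ ⟨hτ.1.le, hτ.2⟩
        rcases le_or_gt τ p with hle | hlt
        · have h3 : min (s - τ + (θ : ℝ)) 0 = 0 := by
            refine min_eq_right ?_
            rcases le_max_iff.1 hle with h4 | h4
            · linarith
            · exact absurd h4 (not_le.2 hτ.1)
          rw [indicator_of_mem (show τ ∈ Iic p from hle), h3]
          simpa using indicator_nonneg (fun _ _ => hC0) τ
        · rw [indicator_of_notMem (show τ ∉ Iic p from not_le.2 hlt), sub_zero, norm_smul,
            Real.norm_of_nonneg (le_max_right _ _)]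
          have h3 : s + (θ : ℝ) ≤ p := le_max_left _ _
          rcases le_or_gt τ (p + 1 / m) with hle' | hlt'
          · rw [indicator_of_mem (show τ ∈ Ioc p (p + 1 / m) from ⟨hlt, hle'⟩)]
            exact (mul_le_of_le_one_left (norm_nonneg _)
              (max_one_add_mul_le_one m (min_le_right _ _))).trans hg
          · have h4 : (m : ℝ) * min (s - τ + (θ : ℝ)) 0 ≤ -1 := by
              have h5 : min (s - τ + (θ : ℝ)) 0 ≤ -(1 / m) := (min_le_left _ _).trans (by linarith)
              refine (mul_le_mul_of_nonneg_left h5 hm'.le).trans_eq ?_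
              field_simp
            rw [max_eq_right (by linarith), zero_mul]
            exact indicator_nonneg (fun _ _ => hC0) τ
    _ ≤ C * (1 / m) := by
        rw [setIntegral_indicator measurableSet_Ioc, setIntegral_const, smul_eq_mul, mul_comm]
        refine mul_le_mul_of_nonneg_left ?_ hC0
        refine (measureReal_mono inter_subset_right measure_Ioc_lt_top.ne).trans_eq ?_
        rw [Real.volume_real_Ioc_of_le (by simp), add_sub_cancel_left]

theorem tendsto_integral_shiftedSpike (g : C(ℝ, EuclideanSpace ℝ (Fin n))) {s : ℝ} (hs : 0 ≤ s) :
    Tendsto (fun m => ∫ τ in Icc 0 s, shiftedSpike g h s m τ) atTop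
      (𝓝 (primitiveState h g s)) := by
  obtain ⟨C, hC⟩ := (isCompact_Icc (a := (0 : ℝ)) (b := s)).exists_bound_of_continuousOn
    g.continuous.continuousOn
  rw [tendsto_iff_norm_sub_tendsto_zero]
  have h1 := tendsto_one_div_atTop_nhds_zero_nat (𝕜 := ℝ) |>.const_mul C
  rw [mul_zero] at h1
  refine squeeze_zero' (Eventually.of_forall fun _ => norm_nonneg _) ?_ h1
  filter_upwards [eventually_gt_atTop 0] with m hm
  exact norm_integral_shiftedSpike_sub_le g hs hC hm

theorem tendsto_shiftedSpike (g : C(ℝ, EuclideanSpace ℝ (Fin n))) (s τ : ℝ) (x : SunDual n h) :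
    Tendsto (fun m => sunInclusion x (shiftedSpike g h s m τ)) atTop
      (𝓝 (sunStarSemigroup (s - τ).toNNReal (∑ i, g τ i • sunStarUnit i) x)) := by
  have h1 : ∀ m, sunInclusion x (shiftedSpike g h s m τ) = ∑ i, g τ i *
      sunInclusion (sunSemigroup (s - τ).toNNReal x) (spike n h i m) := fun m => by
    simp only [shiftedSpike, map_sum, map_smul, smul_eq_mul, sunInclusion_sunSemigroup,
      adjointSemigroup_apply]
  have h2 : sunStarSemigroup (s - τ).toNNReal (∑ i, g τ i • sunStarUnit i) x =
      ∑ i, g τ i * massAtZero i (sunInclusion (sunSemigroup (s - τ).toNNReal x)) := by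
    rw [sunStarSemigroup_apply, sum_apply]
    rfl
  simp only [h1, h2]
  exact tendsto_finsetSum _ fun i _ => (tendsto_massAtZero i _).const_mul _

/-- Each `r_i^{⊙*}` is a weak* limit of spikes in `X`. For the spikes the integral is an honest
integral in `X` and converges in norm to `primitiveState`; tested against `x`, dominated convergence
gives the weak* integral as the same limit. -/
theorem hasWeakStarIntegral_primitiveState (g : C(ℝ, EuclideanSpace ℝ (Fin n))) {s : ℝ}
    (hs : 0 ≤ s) :
    HasWeakStarIntegral
      (fun τ => sunStarSemigroup (s - τ).toNNReal (∑ i, g τ i • sunStarUnit (h := h) i))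
      (Icc 0 s) (sunEmbedding (primitiveState h g s)) := by
  intro x
  have hmeas : ∀ m, AEStronglyMeasurable (fun τ => sunInclusion x (shiftedSpike g h s m τ))
      (volume.restrict (Icc 0 s)) := fun m =>
    ((sunInclusion x).continuous.comp (continuous_shiftedSpike g s m)).aestronglyMeasurable
  have hbound : ∀ m τ, ‖sunInclusion x (shiftedSpike g h s m τ)‖ ≤ ‖sunInclusion x‖ * ‖g τ‖ :=
    fun m τ => ((sunInclusion x).le_opNorm _).trans
      (mul_le_mul_of_nonneg_left (norm_shiftedSpike_le g s m τ) (norm_nonneg _))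
  have hlim := fun τ => tendsto_shiftedSpike g s τ x
  have hdom : IntegrableOn (fun τ => ‖sunInclusion x‖ * ‖g τ‖) (Icc 0 s) :=
    (by fun_prop : Continuous fun τ => ‖sunInclusion x‖ * ‖g τ‖).integrableOn_Icc
  refine ⟨hdom.mono' (aestronglyMeasurable_of_tendsto_ae _ hmeas (Eventually.of_forall hlim))
    (Eventually.of_forall fun τ => le_of_tendsto' (hlim τ).norm fun m => hbound m τ), ?_⟩
  have h1 := tendsto_integral_of_dominated_convergence _ hmeas hdom
    (fun m => Eventually.of_forall (hbound m)) (Eventually.of_forall hlim)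
  refine tendsto_nhds_unique ?_ h1
  rw [sunEmbedding_apply]
  refine (((sunInclusion x).continuous.tendsto _).comp
    (tendsto_integral_shiftedSpike g hs)).congr fun m => ?_
  exact ((sunInclusion x).integral_comp_comm
    (continuous_shiftedSpike g s m).integrableOn_Icc).symm

end WeakStar

/-! ### The embedding of `X` into `X^{⊙*}` is injective -/

section Injective

variable {n : ℕ} {h : ℝ}

theorem shiftSemigroup_shiftSemigroup (s t : NNReal) (u : PhaseSpace n h) :
    shiftSemigroup s (shiftSemigroup t u) = shiftSemigroup (s + t) u := by
  refine PhaseSpace.ext fun θ => ?_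
  simp only [shiftSemigroup_apply]
  congr 1
  ext1
  have hs : (0 : ℝ) ≤ s := s.2
  have ht : (0 : ℝ) ≤ t := t.2
  simp only [shiftMap, ContinuousMap.coe_mk, NNReal.coe_add]
  grind

theorem continuous_dual_shiftSemigroup (x : StrongDual ℝ (PhaseSpace n h)) (u : PhaseSpace n h) :
    Continuous fun r : ℝ => x (shiftSemigroup r.toNNReal u) :=
  x.continuous.comp (continuous_shiftSemigroup.comp
    (by fun_prop : Continuous fun r : ℝ => (r.toNNReal, u)))

theorem norm_dual_shiftSemigroup_le (x : StrongDual ℝ (PhaseSpace n h)) (t : NNReal)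
    (u : PhaseSpace n h) : ‖x (shiftSemigroup t u)‖ ≤ ‖x‖ * ‖u‖ :=
  (x.le_opNorm _).trans (mul_le_mul_of_nonneg_left (norm_shiftSemigroup_apply_le t u)
    (norm_nonneg x))

/-- The functional `u ↦ ∫₀^ε ⟨x, T₀(r) u⟩ dr`. -/
def averagedDual (x : StrongDual ℝ (PhaseSpace n h)) (ε : ℝ) : StrongDual ℝ (PhaseSpace n h) :=
  LinearMap.mkContinuous
    { toFun := fun u => ∫ r in (0 : ℝ)..ε, x (shiftSemigroup r.toNNReal u)
      map_add' := fun u v => by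
        simp only [map_add]
        exact intervalIntegral.integral_add
          ((continuous_dual_shiftSemigroup x u).intervalIntegrable _ _)
          ((continuous_dual_shiftSemigroup x v).intervalIntegrable _ _)
      map_smul' := fun c u => by
        simp only [map_smul]
        exact intervalIntegral.integral_smul c _ }
    (‖x‖ * |ε|) fun u => by
      refine (intervalIntegral.norm_integral_le_of_norm_le_const fun r _ =>
        norm_dual_shiftSemigroup_le x _ u).trans_eq ?_
      rw [sub_zero]; ring

theorem averagedDual_apply (x : StrongDual ℝ (PhaseSpace n h)) (ε : ℝ) (u : PhaseSpace n h) :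
    averagedDual x ε u = ∫ r in (0 : ℝ)..ε, x (shiftSemigroup r.toNNReal u) := rfl

/-- The adjoint semigroup moves the averaging window from `[0, ε]` to `[t, ε + t]`, and the two
integrals differ by integrals over intervals of length `t`. -/
theorem norm_adjointSemigroup_averagedDual_sub_le (x : StrongDual ℝ (PhaseSpace n h)) {ε : ℝ}
    (hε : 0 ≤ ε) (t : NNReal) :
    ‖adjointSemigroup t (averagedDual x ε) - averagedDual x ε‖ ≤ 2 * ‖x‖ * t := by
  refine ContinuousLinearMap.opNorm_le_bound _ (by positivity) fun u => ?_
  have hi : ∀ a b : ℝ, IntervalIntegrable (fun r : ℝ => x (shiftSemigroup r.toNNReal u)) volume a b :=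
    fun a b => (continuous_dual_shiftSemigroup x u).intervalIntegrable a b
  have h1 : adjointSemigroup t (averagedDual x ε) u =
      ∫ r in (t : ℝ)..ε + t, x (shiftSemigroup r.toNNReal u) := by
    rw [adjointSemigroup_apply, averagedDual_apply,
      ← zero_add (t : ℝ), ← add_assoc, add_zero ε, ← intervalIntegral.integral_comp_add_right
        (fun r : ℝ => x (shiftSemigroup r.toNNReal u))]
    refine intervalIntegral.integral_congr fun r hr => ?_
    rw [uIcc_of_le hε] at hr
    simp only [shiftSemigroup_shiftSemigroup]
    rw [Real.toNNReal_add hr.1 t.coe_nonneg, Real.toNNReal_coe]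
  have hb : ∀ a b : ℝ, ‖∫ r in a..b, x (shiftSemigroup r.toNNReal u)‖ ≤ ‖x‖ * ‖u‖ * |b - a| :=
    fun a b => intervalIntegral.norm_integral_le_of_norm_le_const fun r _ =>
      norm_dual_shiftSemigroup_le x _ u
  rw [sub_apply, h1, averagedDual_apply,
    intervalIntegral.integral_interval_sub_interval_comm (hi _ _) (hi _ _) (hi _ _)]
  refine (norm_sub_le _ _).trans ((add_le_add (hb _ _) (hb _ _)).trans_eq ?_)
  simp
  ring

theorem averagedDual_mem_sunSubspace (x : StrongDual ℝ (PhaseSpace n h)) {ε : ℝ} (hε : 0 ≤ ε) :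
    averagedDual x ε ∈ sunSubspace n h := by
  change Tendsto (fun t : NNReal => adjointSemigroup t (averagedDual x ε)) (𝓝[>] 0) _
  rw [tendsto_iff_norm_sub_tendsto_zero]
  refine squeeze_zero (fun _ => norm_nonneg _)
    (fun t => norm_adjointSemigroup_averagedDual_sub_le x hε t) ?_
  have h1 : Continuous fun t : NNReal => 2 * ‖x‖ * (t : ℝ) := by fun_prop
  simpa using (h1.tendsto 0).mono_left nhdsWithin_le_nhds

/-- Averages of any `x ∈ X^*` lie in `X^⊙`, so they vanish at `w` when `ι w = 0`. Differentiating
them in `ε` from the right at `0` recovers `x w = 0`. -/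
theorem sunEmbedding_injective :
    Function.Injective (sunEmbedding : PhaseSpace n h →L[ℝ] SunStarDual n h) := by
  refine (injective_iff_map_eq_zero _).2 fun w hw => ?_
  refine (SeparatingDual.eq_zero_iff_forall_dual_eq_zero (R := ℝ) w).2 fun x => ?_
  have h1 : ∀ ε : ℝ, 0 ≤ ε → ∫ r in (0 : ℝ)..ε, x (shiftSemigroup r.toNNReal w) = 0 := fun ε hε => by
    have h2 : sunEmbedding w (⟨averagedDual x ε, averagedDual_mem_sunSubspace x hε⟩ :
      sunSubspace n h) = 0 := by rw [hw]; rfl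
    exact h2
  have h3 := (intervalIntegral.integral_hasDerivAt_right
    ((continuous_dual_shiftSemigroup x w).intervalIntegrable 0 0)
    ((continuous_dual_shiftSemigroup x w).stronglyMeasurableAtFilter _ _)
    (continuous_dual_shiftSemigroup x w).continuousAt).hasDerivWithinAt (s := Ici 0)
  have h4 := (hasDerivWithinAt_const (0 : ℝ) (Ici 0) (0 : ℝ)).congr h1 (h1 0 le_rfl)
  have h5 := (uniqueDiffWithinAt_Ici (0 : ℝ)).eq_deriv _ h3 h4
  simpa [shiftSemigroup_zero] using h5

end Injective

/-! ### Solutions as continuous curves -/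

section Solutions

variable {n : ℕ} {h : ℝ} {O : Set (PhaseSpace n h)}
  {f : PhaseSpace n h → EuclideanSpace ℝ (Fin n)}

theorem HasWeakStarIntegral.unique {E : Type*} [NormedAddCommGroup E] [NormedSpace ℝ E]
    {g : ℝ → StrongDual ℝ E} {s : Set ℝ} {I J : StrongDual ℝ E}
    (hI : HasWeakStarIntegral g s I) (hJ : HasWeakStarIntegral g s J) : I = J :=
  ContinuousLinearMap.ext fun x => (hI x).2.trans (hJ x).2.symm

theorem HasWeakStarIntegral.congr {E : Type*} [NormedAddCommGroup E] [NormedSpace ℝ E]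
    {g g' : ℝ → StrongDual ℝ E} {s : Set ℝ} {I : StrongDual ℝ E} (hs : MeasurableSet s)
    (hI : HasWeakStarIntegral g s I) (hg : ∀ τ ∈ s, g τ = g' τ) : HasWeakStarIntegral g' s I :=
  fun x => ⟨(hI x).1.congr_fun (fun τ hτ => by simp only [hg τ hτ]) hs,
    (hI x).2.trans (setIntegral_congr_fun hs fun τ hτ => by simp only [hg τ hτ])⟩

/-- `z ∈ C([0, t]; X)` takes values in `O` and satisfies the variation-of-constants equation in
integrated form. -/
def IsMildSolution (O : Set (PhaseSpace n h)) (f : PhaseSpace n h → EuclideanSpace ℝ (Fin n))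
    {t : ℝ} (ht : 0 ≤ t) (u : PhaseSpace n h) (z : C(Icc 0 t, PhaseSpace n h)) : Prop :=
  (∀ s, z s ∈ O) ∧ z = shiftCurve t u + primitiveCurve h ht (superposition f z)

theorem hasWeakStarIntegral_superposition (hf : ContinuousOn f O) {t : ℝ} (ht : 0 ≤ t)
    {x : ℝ → PhaseSpace n h} {z : C(Icc 0 t, PhaseSpace n h)} (hxz : ∀ s : Icc 0 t, x s = z s)
    (hz : ∀ s, z s ∈ O) (s : Icc 0 t) :
    HasWeakStarIntegral
      (fun τ => sunStarSemigroup (s - τ).toNNReal (sunStarRhs f (x τ))) (Icc 0 (s : ℝ))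
      (sunEmbedding (primitiveCurve h ht (superposition f z) s)) := by
  refine (hasWeakStarIntegral_primitiveState (h := h) (extendCurve ht (superposition f z))
    s.2.1).congr measurableSet_Icc fun τ hτ => ?_
  have hτ' : τ ∈ Icc 0 t := ⟨hτ.1, hτ.2.trans s.2.2⟩
  rw [extendCurve_of_mem ht _ hτ', superposition_apply hf hz, ← hxz]
  rfl

/-- Both sides of the curve equation have the same image under `ι`, since weak* integrals are
unique; injectivity of `ι` removes it. -/
theorem isSolution_iff_isMildSolution (hf : ContinuousOn f O) {t : ℝ} (ht : 0 ≤ t)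
    {u : PhaseSpace n h} {x : ℝ → PhaseSpace n h} {z : C(Icc 0 t, PhaseSpace n h)}
    (hxz : ∀ s : Icc 0 t, x s = z s) : IsSolution O f u t x ↔ IsMildSolution O f ht u z := by
  constructor
  · intro hx
    have hz : ∀ s, z s ∈ O := fun s => hxz s ▸ hx.mem s s.2
    refine ⟨hz, ContinuousMap.ext fun s => ?_⟩
    have h1 := sunEmbedding_injective
      ((hx.eq s s.2).unique (hasWeakStarIntegral_superposition hf ht hxz hz s))
    rw [ContinuousMap.add_apply, shiftCurve_apply, ← h1, ← hxz, add_sub_cancel]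
  · rintro ⟨hz, he⟩
    refine ⟨?_, fun s hs => hxz ⟨s, hs⟩ ▸ hz _, fun s hs => ?_⟩
    · rw [continuousOn_iff_continuous_domRestrict]
      exact z.continuous.congr fun s => (hxz s).symm
    · have h1 := congrArg (fun y : C(Icc 0 t, PhaseSpace n h) => y ⟨s, hs⟩) he
      simp only [ContinuousMap.add_apply, shiftCurve_apply] at h1
      rw [hxz ⟨s, hs⟩, h1, add_sub_cancel_left]
      exact hasWeakStarIntegral_superposition hf ht hxz hz ⟨s, hs⟩

theorem IsSolution.mono {u : PhaseSpace n h} {s t : ℝ} {x : ℝ → PhaseSpace n h}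
    (hx : IsSolution O f u t x) (hst : s ≤ t) : IsSolution O f u s x :=
  ⟨hx.continuousOn.mono (Icc_subset_Icc_right hst),
    fun r hr => hx.mem r ⟨hr.1, hr.2.trans hst⟩, fun r hr => hx.eq r ⟨hr.1, hr.2.trans hst⟩⟩

theorem norm_primitiveCurve_sub_apply_le {t : ℝ} (ht : 0 ≤ t)
    (g g' : C(Icc 0 t, EuclideanSpace ℝ (Fin n))) (s : Icc 0 t) :
    ‖primitiveCurve h ht g s - primitiveCurve h ht g' s‖ ≤
      ∫ τ in (0 : ℝ)..s, ‖extendCurve ht (g - g') τ‖ := by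
  rw [← ContinuousMap.sub_apply, ← map_sub]
  exact norm_primitiveCurve_apply_le ht _ s

theorem exists_lipschitzOnWith_of_isCompact {E F : Type*} [NormedAddCommGroup E] [NormedSpace ℝ E]
    [NormedAddCommGroup F] [NormedSpace ℝ F] {f : E → F} {O K : Set E} (hO : IsOpen O)
    (hf : ContDiffOn ℝ 1 f O) (hK : IsCompact K) (hKO : K ⊆ O) :
    ∃ L, LipschitzOnWith L f K := by
  refine LocallyLipschitzOn.exists_lipschitzOnWith_of_compact hK fun p hp => ?_
  obtain ⟨L, S, hS, hL⟩ := (hf.contDiffAt (hO.mem_nhds (hKO hp))).exists_lipschitzOnWith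
  exact ⟨L, S, mem_nhdsWithin_of_mem_nhds hS, hL⟩

/-- The two ranges together are compact, so `f` has one Lipschitz constant there, and Gronwall
applies to `‖z - z'‖`. -/
theorem IsMildSolution.unique (hO : IsOpen O) (hf : ContDiffOn ℝ 1 f O) {t : ℝ} {ht : 0 ≤ t}
    {u : PhaseSpace n h} {z z' : C(Icc 0 t, PhaseSpace n h)} (hz : IsMildSolution O f ht u z)
    (hz' : IsMildSolution O f ht u z') : z = z' := by
  obtain ⟨L, hL⟩ := exists_lipschitzOnWith_of_isCompact hO hf
    ((isCompact_range z.continuous).union (isCompact_range z'.continuous))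
    (by rintro _ (⟨s, rfl⟩ | ⟨s, rfl⟩); exacts [hz.1 s, hz'.1 s])
  have hd : Continuous fun τ => ‖extendCurve ht (z - z') τ‖ :=
    (extendCurve ht (z - z')).continuous.norm
  have h1 := nonpos_of_le_mul_integral hd (t := t) L.2 fun s hs => by
    rw [extendCurve_of_mem ht _ hs, ContinuousMap.sub_apply]
    -- Only the values at `s` are expanded; the curves under the integral stay.
    nth_rewrite 1 [hz.2, hz'.2]
    rw [ContinuousMap.add_apply, ContinuousMap.add_apply, add_sub_add_left_eq_sub]
    refine (norm_primitiveCurve_sub_apply_le ht _ _ _).trans ?_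
    rw [← intervalIntegral.integral_const_mul]
    refine intervalIntegral.integral_mono_on hs.1
      ((extendCurve ht _).continuous.norm.intervalIntegrable _ _)
      ((hd.const_mul _).intervalIntegrable _ _) fun τ hτ => ?_
    have hτ' : τ ∈ Icc 0 t := ⟨hτ.1, hτ.2.trans hs.2⟩
    rw [extendCurve_of_mem ht _ hτ', extendCurve_of_mem ht _ hτ', ContinuousMap.sub_apply,
      ContinuousMap.sub_apply, superposition_apply hf.continuousOn hz.1,
      superposition_apply hf.continuousOn hz'.1]
    exact hL.norm_sub_le (Or.inl ⟨_, rfl⟩) (Or.inr ⟨_, rfl⟩)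
  refine ContinuousMap.ext fun s => sub_eq_zero.1 (norm_le_zero_iff.1 ?_)
  have h2 := h1 s s.2
  rwa [extendCurve_of_mem ht _ s.2] at h2

theorem IsSolution.semiflow_eq (hO : IsOpen O) (hf : ContDiffOn ℝ 1 f O) {u : PhaseSpace n h}
    {t : ℝ} {x : ℝ → PhaseSpace n h} (hx : IsSolution O f u t x) (ht : 0 ≤ t) :
    semiflow O f t u = x t := by
  have he : ∃ x, IsSolution O f u t x := ⟨x, hx⟩
  rw [semiflow, dif_pos he]
  have key : ∀ {y : ℝ → PhaseSpace n h} (hy : IsSolution O f u t y), IsMildSolution O f ht u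
      ⟨(Icc 0 t).domRestrict y, hy.continuousOn.domRestrict⟩ := fun hy =>
    (isSolution_iff_isMildSolution hf.continuousOn ht fun _ => rfl).1 hy
  exact congrArg (fun y : C(Icc 0 t, PhaseSpace n h) => y ⟨t, ht, le_rfl⟩)
    ((key he.choose_spec).unique hO hf (key hx))

/-- `semiflow` chooses a solution separately for each time; restriction to `[0, s]` and uniqueness
place all these choices on the one curve `z`. -/
theorem IsMildSolution.semiflow_eq (hO : IsOpen O) (hf : ContDiffOn ℝ 1 f O) {u : PhaseSpace n h}
    {t : ℝ} {ht : 0 ≤ t} {z : C(Icc 0 t, PhaseSpace n h)} (hz : IsMildSolution O f ht u z)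
    (s : Icc 0 t) : semiflow O f s u = z s := by
  have hx : IsSolution O f u t (IccExtend ht z) :=
    (isSolution_iff_isMildSolution hf.continuousOn ht fun s => IccExtend_val ht z s).2 hz
  rw [(hx.mono s.2.2).semiflow_eq hO hf s.2.1, IccExtend_val]

theorem IsMildSolution.mem_semiflowDomain (hf : ContinuousOn f O) {u : PhaseSpace n h}
    {t : ℝ} {ht : 0 ≤ t} {z : C(Icc 0 t, PhaseSpace n h)} (hz : IsMildSolution O f ht u z) :
    u ∈ semiflowDomain O f t := by
  refine ⟨?_, IccExtend ht z,
    (isSolution_iff_isMildSolution hf ht fun s => IccExtend_val ht z s).2 hz⟩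
  -- The integral over `[0, 0]` vanishes, so `z 0 = u` and thus `u ∈ O`.
  have h0 := hz.1 ⟨0, le_rfl, ht⟩
  rw [hz.2, ContinuousMap.add_apply, shiftCurve_apply, Real.toNNReal_zero, shiftSemigroup_zero] at h0
  have h1 := norm_primitiveCurve_apply_le (h := h) ht (superposition f z) ⟨0, le_rfl, ht⟩
  rw [intervalIntegral.integral_same, norm_le_zero_iff] at h1
  rwa [h1, add_zero] at h0

theorem exists_isMildSolution_of_mem (hf : ContinuousOn f O) {u : PhaseSpace n h} {t : ℝ}
    (ht : 0 ≤ t) (hu : u ∈ semiflowDomain O f t) : ∃ z, IsMildSolution O f ht u z := by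
  obtain ⟨-, x, hx⟩ := hu
  exact ⟨⟨(Icc 0 t).domRestrict x, hx.continuousOn.domRestrict⟩,
    (isSolution_iff_isMildSolution hf ht fun _ => rfl).1 hx⟩

end Solutions

/-! ### Local existence -/

section Existence

variable {n : ℕ} {h : ℝ} {O : Set (PhaseSpace n h)}
  {f : PhaseSpace n h → EuclideanSpace ℝ (Fin n)}

theorem norm_primitiveCurve_apply_le_mul {t : ℝ} (ht : 0 ≤ t)
    (g : C(Icc 0 t, EuclideanSpace ℝ (Fin n))) : ‖primitiveCurve h ht g‖ ≤ t * ‖g‖ :=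
  (primitiveCurve h ht).le_of_opNorm_le (norm_primitiveCurve_le ht) g

/-- Contraction on the closed `δ`-ball about the constant curve `u`. Small `t` keeps the shift part
and the integral part within `δ / 2` each, and `t * L ≤ 1 / 2` gives the contraction. -/
theorem exists_isMildSolution (hO : IsOpen O) (hf : ContDiffOn ℝ 1 f O) {u : PhaseSpace n h}
    (hu : u ∈ O) : ∃ t : ℝ, ∃ ht : 0 < t, ∃ z, IsMildSolution O f ht.le u z := by
  obtain ⟨L, S, hS, hL⟩ := (hf.contDiffAt (hO.mem_nhds hu)).exists_lipschitzOnWith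
  obtain ⟨δ, hδ, hball⟩ := Metric.nhds_basis_closedBall.mem_iff.1
    (inter_mem hS (hO.mem_nhds hu))
  have hLb : LipschitzOnWith L f (Metric.closedBall u δ) := hL.mono fun p hp => (hball hp).1
  have hbO : Metric.closedBall u δ ⊆ O := fun p hp => (hball hp).2
  -- A bound for `‖f‖` on the `δ`-ball, from the Lipschitz estimate.
  set M : ℝ := ‖f u‖ + L * δ with hM
  have hT : Continuous fun s : ℝ => shiftSemigroup s.toNNReal u :=
    continuous_shiftSemigroup.comp (by fun_prop : Continuous fun s : ℝ => (s.toNNReal, u))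
  obtain ⟨η, hη, hTη⟩ := Metric.continuousAt_iff.1 (hT.continuousAt (x := 0)) (δ / 2) (half_pos hδ)
  have hsmall : ∀ c : ℝ, ∀ b > (0 : ℝ), ∀ᶠ t in 𝓝[>] (0 : ℝ), t * c ≤ b := fun c b hb => by
    have h1 : Tendsto (fun t : ℝ => t * c) (𝓝 0) (𝓝 (0 * c)) := (continuous_mul_const c).tendsto 0
    rw [zero_mul] at h1
    exact nhdsWithin_le_nhds (h1.eventually (ge_mem_nhds hb))
  obtain ⟨t, ⟨⟨htL, htM⟩, htη⟩, ht⟩ := (((hsmall L (1 / 2) one_half_pos).and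
    (hsmall M (δ / 2) (half_pos hδ))).and (nhdsWithin_le_nhds (gt_mem_nhds hη))).and
    self_mem_nhdsWithin |>.exists
  refine ⟨t, ht, ?_⟩
  replace ht : 0 < t := ht
  set B : Set C(Icc 0 t, PhaseSpace n h) :=
    Metric.closedBall (ContinuousMap.const _ u) δ with hB
  set Ψ : C(Icc 0 t, PhaseSpace n h) → C(Icc 0 t, PhaseSpace n h) := fun z =>
    shiftCurve t u + primitiveCurve h ht.le (superposition f z) with hΨ
  have hzB : ∀ z ∈ B, ∀ s, z s ∈ Metric.closedBall u δ := fun z hz s =>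
    (ContinuousMap.dist_apply_le_dist s).trans hz
  have happ : ∀ z ∈ B, ∀ s, superposition f z s = f (z s) := fun z hz =>
    superposition_apply hf.continuousOn fun s => hbO (hzB z hz s)
  have hmaps : MapsTo Ψ B B := fun z hz => by
    refine (ContinuousMap.dist_le hδ.le).2 fun s => ?_
    have h1 : dist (shiftSemigroup (s : ℝ).toNNReal u) u ≤ δ / 2 := by
      have h2 := hTη (x := (s : ℝ)) (by
        rw [Real.dist_eq, sub_zero, abs_of_nonneg s.2.1]; exact s.2.2.trans_lt htη)
      rw [Real.toNNReal_zero, shiftSemigroup_zero] at h2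
      exact h2.le
    have h3 : ‖superposition f z‖ ≤ M :=
      (ContinuousMap.norm_le _ (by positivity)).2 fun s => by
        rw [happ z hz]
        have h4 := hLb.norm_sub_le (hzB z hz s) (Metric.mem_closedBall_self hδ.le)
        have h5 : ‖z s - u‖ ≤ δ := by rw [← dist_eq_norm]; exact hzB z hz s
        have h6 : ‖f (z s)‖ ≤ ‖f u‖ + ‖f (z s) - f u‖ := by
          simpa using norm_add_le (f u) (f (z s) - f u)
        exact h6.trans (add_le_add_right (h4.trans (mul_le_mul_of_nonneg_left h5 L.2)) _)
    have h7 : ‖primitiveCurve h ht.le (superposition f z) s‖ ≤ δ / 2 :=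
      (ContinuousMap.norm_coe_le_norm _ s).trans ((norm_primitiveCurve_apply_le_mul ht.le _).trans
        ((mul_le_mul_of_nonneg_left h3 ht.le).trans htM))
    simp only [hΨ, ContinuousMap.add_apply, ContinuousMap.const_apply, shiftCurve_apply]
    rw [dist_eq_norm] at h1 ⊢
    rw [add_sub_right_comm]
    exact (norm_add_le _ _).trans ((add_le_add h1 h7).trans_eq (add_halves δ))
  have hcontr : ContractingWith (1 / 2 : NNReal) (hmaps.restrict Ψ B B) := by
    refine ⟨by norm_num, LipschitzWith.of_dist_le_mul fun z z' => ?_⟩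
    rw [Subtype.dist_eq, Subtype.dist_eq, MapsTo.val_restrict_apply, MapsTo.val_restrict_apply]
    have h1 : ‖superposition f (z : C(Icc 0 t, PhaseSpace n h)) - superposition f z'‖ ≤
        L * dist (z : C(Icc 0 t, PhaseSpace n h)) z' :=
      (ContinuousMap.norm_le _ (by positivity)).2 fun s => by
        rw [ContinuousMap.sub_apply, happ z z.2, happ z' z'.2, ← dist_eq_norm]
        exact (hLb.dist_le_mul _ (hzB z z.2 s) _ (hzB z' z'.2 s)).trans
          (mul_le_mul_of_nonneg_left (ContinuousMap.dist_apply_le_dist s) L.2)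
    simp only [hΨ, dist_add_left]
    rw [dist_eq_norm, ← map_sub]
    refine (norm_primitiveCurve_apply_le_mul ht.le _).trans
      ((mul_le_mul_of_nonneg_left h1 ht.le).trans ?_)
    rw [← mul_assoc]
    exact mul_le_mul_of_nonneg_right (by simpa using htL) dist_nonneg
  obtain ⟨z, hz, hfix, -⟩ := hcontr.exists_fixedPoint' Metric.isClosed_closedBall.isComplete hmaps
    (Metric.mem_closedBall_self hδ.le) (edist_ne_top _ _)
  exact ⟨z, fun s => hbO (hzB z hz s), hfix.symm⟩

end Existence

/-! ### Smooth dependence on the initial state -/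

section Smoothness

variable {n : ℕ} {h : ℝ} {O : Set (PhaseSpace n h)}
  {f : PhaseSpace n h → EuclideanSpace ℝ (Fin n)}

theorem isUnit_one_sub_primitiveCurve_comp {t : ℝ} (ht : 0 ≤ t)
    (A : C(Icc 0 t, PhaseSpace n h →L[ℝ] EuclideanSpace ℝ (Fin n))) :
    IsUnit (1 - (primitiveCurve h ht).comp (pointwiseApply A)) := by
  refine isUnit_one_sub_of_volterra ht _ (norm_nonneg A) fun y s => ?_
  refine (norm_primitiveCurve_apply_le ht _ s).trans ?_
  rw [← intervalIntegral.integral_const_mul]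
  refine intervalIntegral.integral_mono_on s.2.1
    ((extendCurve ht _).continuous.norm.intervalIntegrable _ _)
    (((extendCurve ht y).continuous.norm.const_mul _).intervalIntegrable _ _) fun τ hτ => ?_
  have hτ' : τ ∈ Icc 0 t := ⟨hτ.1, hτ.2.trans s.2.2⟩
  rw [extendCurve_of_mem ht _ hτ', extendCurve_of_mem ht _ hτ']
  exact (A ⟨τ, hτ'⟩).le_of_opNorm_le (A.norm_coe_le_norm _) _

/-- Solutions starting at `w` are the preimages of `shiftCurve t w` under `Φ` with values in `O`, so
a local inverse of `Φ` at `z` yields them as a `C^k` family. -/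
theorem exists_contDiffOn_isMildSolution {k : ℕ} (hk : 1 ≤ k) (hO : IsOpen O)
    (hf : ContDiffOn ℝ k f O) {t : ℝ} (ht : 0 ≤ t) {u : PhaseSpace n h}
    {z : C(Icc 0 t, PhaseSpace n h)} (hz : IsMildSolution O f ht u z) :
    ∃ U : Set (PhaseSpace n h), IsOpen U ∧ u ∈ U ∧
      ∃ ψ : PhaseSpace n h → C(Icc 0 t, PhaseSpace n h),
        ContDiffOn ℝ k ψ U ∧ ∀ w ∈ U, IsMildSolution O f ht w (ψ w) := by
  have hk0 : (k : WithTop ℕ∞) ≠ 0 := by exact_mod_cast (Nat.one_le_iff_ne_zero.1 hk)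
  have hΩ : IsOpen {y : C(Icc 0 t, PhaseSpace n h) | ∀ s, y s ∈ O} := isOpen_setOf_forall_mem hO
  set Φ : C(Icc 0 t, PhaseSpace n h) → C(Icc 0 t, PhaseSpace n h) := fun y =>
    y - primitiveCurve h ht (superposition f y) with hΦ
  have hΦk : ContDiffAt ℝ k Φ z := contDiffAt_id.sub
    ((primitiveCurve h ht).contDiff.contDiffAt.comp z
      ((contDiffOn_superposition k hO hf).contDiffAt (hΩ.mem_nhds hz.1)))
  obtain ⟨e, he⟩ := isUnit_one_sub_primitiveCurve_comp ht (superposition (fderiv ℝ f) z)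
  have hΦ' : HasFDerivAt Φ (ContinuousLinearEquiv.unitsEquiv ℝ _ e :
      C(Icc 0 t, PhaseSpace n h) →L[ℝ] C(Icc 0 t, PhaseSpace n h)) z := by
    have h1 := (hasFDerivAt_id z).sub ((primitiveCurve h ht).hasFDerivAt.comp z
      (hasFDerivAt_superposition hO (hf.of_le (by exact_mod_cast hk)) hz.1))
    exact h1.congr_fderiv he.symm
  have hΦu : Φ z = shiftCurve t u := by
    rw [hΦ, sub_eq_iff_eq_add]; exact hz.2
  set ψ := hΦk.localInverse hΦ' hk0 with hψ
  have hψk : ContDiffAt ℝ k ψ (Φ z) := hΦk.to_localInverse hΦ' hk0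
  have hψz : ψ (Φ z) = z := hΦk.localInverse_apply_image hΦ' hk0
  have h1 : ∀ᶠ y in 𝓝 (Φ z), Φ (ψ y) = y :=
    (hΦk.hasStrictFDerivAt' hΦ' hk0).eventually_right_inverse
  -- Being `C^k` at a point persists nearby because `k` is finite.
  have h2 : ∀ᶠ y in 𝓝 (Φ z), ContDiffAt ℝ k ψ y := hψk.eventually (by simp)
  have h3 : ∀ᶠ y in 𝓝 (Φ z), ∀ s, ψ y s ∈ O :=
    hψk.continuousAt.preimage_mem_nhds (hΩ.mem_nhds (by rw [hψz]; exact hz.1))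
  have h4 := (shiftCurve (n := n) (h := h) t).continuous.tendsto u
  rw [← hΦu] at h4
  obtain ⟨U, hU, hUo, huU⟩ := eventually_nhds_iff.1 (h4.eventually (h1.and (h2.and h3)))
  refine ⟨U, hUo, huU, fun w => ψ (shiftCurve t w), fun w hw => ?_, fun w hw => ⟨(hU w hw).2.2, ?_⟩⟩
  · exact ((hU w hw).2.1.comp w (shiftCurve t).contDiff.contDiffAt).contDiffWithinAt
  · exact sub_eq_iff_eq_add.1 (hU w hw).1

theorem iteratedFDeriv_semiflow {k : ℕ} {t : ℝ} {U : Set (PhaseSpace n h)} (hU : IsOpen U)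
    {ψ : PhaseSpace n h → C(Icc 0 t, PhaseSpace n h)} (hψ : ContDiffOn ℝ k ψ U)
    (hψs : ∀ w ∈ U, ∀ s : Icc 0 t, semiflow O f s w = ψ w s) {j : ℕ} (hj : j ≤ k)
    (v : Fin j → PhaseSpace n h) (s : Icc 0 t) {w : PhaseSpace n h} (hw : w ∈ U) :
    iteratedFDeriv ℝ j (semiflow O f s) w v = iteratedFDeriv ℝ j ψ w v s := by
  have h1 : semiflow O f s =ᶠ[𝓝 w] ContinuousMap.evalCLM ℝ s ∘ ψ := by
    filter_upwards [hU.mem_nhds hw] with y hy using hψs y hy s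
  rw [(h1.iteratedFDeriv ℝ j).eq_of_nhds, ContinuousLinearMap.iteratedFDeriv_comp_left _
    (hψ.contDiffAt (hU.mem_nhds hw)) (by exact_mod_cast hj)]
  rfl

theorem continuousOn_iteratedFDeriv_semiflow {k : ℕ} {t : ℝ} (ht : 0 ≤ t)
    {U : Set (PhaseSpace n h)} (hU : IsOpen U)
    {ψ : PhaseSpace n h → C(Icc 0 t, PhaseSpace n h)} (hψ : ContDiffOn ℝ k ψ U)
    (hψs : ∀ w ∈ U, ∀ s : Icc 0 t, semiflow O f s w = ψ w s) {j : ℕ} (hj : j ≤ k)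
    (v : Fin j → PhaseSpace n h) :
    ContinuousOn (fun p : ℝ × PhaseSpace n h => iteratedFDeriv ℝ j (semiflow O f p.1) p.2 v)
      (Icc 0 t ×ˢ U) := by
  have h1 : ContinuousOn (fun w => iteratedFDeriv ℝ j ψ w v) U := by
    have h2 := (hψ.continuousOn_iteratedFDerivWithin (by exact_mod_cast hj) hU.uniqueDiffOn).congr
      fun w hw => (iteratedFDerivWithin_of_isOpen j hU hw).symm
    exact (ContinuousMultilinearMap.apply ℝ (fun _ : Fin j => PhaseSpace n h) _ v).continuous
      |>.comp_continuousOn h2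
  -- The `j`-th derivative of `ψ` along `v` is a curve depending continuously on `w`, and evaluation
  -- of curves is jointly continuous. `projIcc` only makes the expression meaningful for all real
  -- times.
  have h3 : ContinuousOn (fun p : ℝ × PhaseSpace n h =>
      iteratedFDeriv ℝ j ψ p.2 v (projIcc 0 t ht p.1)) (Icc 0 t ×ˢ U) :=
    (h1.comp continuousOn_snd fun p hp => hp.2).eval
      (continuous_projIcc.comp continuous_fst).continuousOn
  refine h3.congr fun p hp => ?_
  simp only [projIcc_of_mem ht hp.1]
  exact iteratedFDeriv_semiflow hU hψ hψs hj v ⟨p.1, hp.1⟩ hp.2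

theorem exists_contDiffOn_semiflow {k : ℕ} (hk : 1 ≤ k) (hO : IsOpen O)
    (hf : ContDiffOn ℝ k f O) {t : ℝ} (ht : 0 ≤ t) {u : PhaseSpace n h}
    (hu : u ∈ semiflowDomain O f t) :
    ∃ U : Set (PhaseSpace n h), IsOpen U ∧ u ∈ U ∧ U ⊆ semiflowDomain O f t ∧
      (∀ s ∈ Icc 0 t, ContDiffOn ℝ k (semiflow O f s) U) ∧
      ∀ j : ℕ, j ≤ k → ∀ v : Fin j → PhaseSpace n h,
        ContinuousOn (fun p : ℝ × PhaseSpace n h =>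
          iteratedFDeriv ℝ j (semiflow O f p.1) p.2 v) (Icc 0 t ×ˢ U) := by
  have hf1 : ContDiffOn ℝ 1 f O := hf.of_le (by exact_mod_cast hk)
  obtain ⟨z, hz⟩ := exists_isMildSolution_of_mem hf.continuousOn ht hu
  obtain ⟨U, hU, huU, ψ, hψ, hsol⟩ := exists_contDiffOn_isMildSolution hk hO hf ht hz
  have hψs : ∀ w ∈ U, ∀ s : Icc 0 t, semiflow O f s w = ψ w s := fun w hw s =>
    (hsol w hw).semiflow_eq hO hf1 s
  refine ⟨U, hU, huU, fun w hw => (hsol w hw).mem_semiflowDomain hf.continuousOn, fun s hs => ?_,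
    fun j hj v => continuousOn_iteratedFDeriv_semiflow ht hU hψ hψs hj v⟩
  have h1 := (ContinuousMap.evalCLM ℝ (M := PhaseSpace n h) (⟨s, hs⟩ : Icc 0 t)).contDiff
    |>.comp_contDiffOn hψ
  exact h1.congr fun w hw => hψs w hw ⟨s, hs⟩

end Smoothness

end

end DelayEq

theorem propositionB2 (n : ℕ) (h : ℝ) (hh : 0 < h) (k : ℕ) (hk : 1 ≤ k)
    (O : Set (DelayEq.PhaseSpace n h)) (hO : IsOpen O)
    (f : DelayEq.PhaseSpace n h → EuclideanSpace ℝ (Fin n)) (hf : ContDiffOn ℝ k f O) :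
    (∀ u ∈ O, ∃ t : ℝ, 0 < t ∧ ∃ U : Set (DelayEq.PhaseSpace n h),
      IsOpen U ∧ u ∈ U ∧ U ⊆ DelayEq.semiflowDomain O f t ∧
      ContDiffOn ℝ k (DelayEq.semiflow O f t) U ∧
      (∀ s ∈ Set.Icc 0 t, ContDiffOn ℝ k (DelayEq.semiflow O f s) U) ∧
      ∀ j : ℕ, j ≤ k → ∀ v : Fin j → DelayEq.PhaseSpace n h,
        ContinuousOn (fun p : ℝ × DelayEq.PhaseSpace n h =>
          iteratedFDeriv ℝ j (DelayEq.semiflow O f p.1) p.2 v) (Set.Icc 0 t ×ˢ U)) ∧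
    (∀ t : ℝ, 0 ≤ t → IsOpen (DelayEq.semiflowDomain O f t) ∧
      ContDiffOn ℝ k (DelayEq.semiflow O f t) (DelayEq.semiflowDomain O f t)) := by
  refine ⟨fun u hu => ?_, fun t ht => ⟨?_, fun u hu => ?_⟩⟩
  · obtain ⟨t, ht, z, hz⟩ := DelayEq.exists_isMildSolution hO (hf.of_le (by exact_mod_cast hk)) hu
    obtain ⟨U, hU, huU, hUD, hs, hj⟩ := DelayEq.exists_contDiffOn_semiflow hk hO hf ht.le
      (hz.mem_semiflowDomain hf.continuousOn)
    exact ⟨t, ht, U, hU, huU, hUD, hs t ⟨ht.le, le_rfl⟩, hs, hj⟩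
  · refine isOpen_iff_mem_nhds.2 fun u hu => ?_
    obtain ⟨U, hU, huU, hUD, -⟩ := DelayEq.exists_contDiffOn_semiflow hk hO hf ht hu
    exact mem_of_superset (hU.mem_nhds huU) hUD
  · obtain ⟨U, hU, huU, -, hs, -⟩ := DelayEq.exists_contDiffOn_semiflow hk hO hf ht hu
    exact ((hs t ⟨ht, le_rfl⟩).contDiffAt (hU.mem_nhds huU)).contDiffWithinAt
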